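/- Let $n\ge 1$, $m\ge 0$, $A\in\mathbb C^{n\times n}$ and $B\in\mathbb C^{n\times m}$. For $\gamma>0$ and $\theta\in\mathbb R$ put $$C=\begin{bmatrix}A&\tfrac1\gamma BB^*-\gamma I\\ \gamma I&-A^*\end{bmatrix},\qquad D_\theta=\begin{bmatrix}-\mathbf i e^{\mathbf i\theta}I&0\\0&\mathbf i e^{-\mathbf i\theta}I\end{bmatrix},\qquad \Lambda(C,D_\theta)=\{\lambda\in\mathbb C:\det(C-\lambda D_\theta)=0\},$$ let $\operatorname{Arg}$ be the principal argument with values in $(-\pi,\pi]$, and define $$f_\gamma(\theta)=\min\{\operatorname{Arg}(-\mathbf i\lambda)^2:\lambda\in\Lambda(C,D_\theta),\ \operatorname{Re}\lambda\le 0\},\qquad \mathcal F(\gamma)=\operatorname{int}\{\theta\in(-\pi,\pi]: f_\gamma(\theta)=0\}.$$ Let $f(r,\theta)=\sigma_{\min}([A-re^{\mathbf i\theta}I\ \ B])$ be the smallest singular value, let $\mu$ be Lebesgue measure on $\mathbb R$, let $\Lambda(\cdot)$ denote the spectrum of a matrix, and let $\tau(A,B)$ be the distance to uncontrollability, i.e.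 the infimum of the spectral norms $\|[A-A'\ \ B-B']\|$ over all pairs $(A',B')$ for which the system $\dot x=A'x+B'u$ is not controllable (a system is controllable if for all $T>0$ and all states $x_0,x_1$ some control $u$ on $[0,T]$ steers $x(0)=x_0$ to $x(T)=x_1$). Then for every $\gamma>0$ with $\gamma^2\notin\Lambda(AA^*+BB^*)$, the minimum defining $f_\gamma(\theta)$ is attained for every $\theta\in(-\pi,\pi]$, and: 1. $f_\gamma(\theta)\ge 0$ for all $\theta\in(-\pi,\pi]$; 2. for $\theta\in(-\pi,\pi]$, $f_\gamma(\theta)=0$ if and only if there is a real $r>0$ with $\mathbf i r\in\Lambda(C,D_\theta)$; 3. $f_\gamma$ is continuous on $(-\pi,\pi]$; 4. $f_\gamma$ is differentiable at $\theta\in(-\pi,\pi]$ (at $\theta=\pi$: as the $2\pi$-periodic function on $\mathbb R$ given by the same formula) if the eigenvalue $\lambda\in\Lambda(C,D_\theta)$ with $\operatorname{Re}\lambda\le0$ that attains the value $f_\gamma(\theta)$ is unique and is simple, i.e. has algebraic multiplicity one; 5. if $\tau(A,B)<\gamma$, then $\mu(\mathcal F(\gamma))>0$; 6. if $\gamma_1,\gamma_2>0$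 with $\gamma_1^2,\gamma_2^2\notin\Lambda(AA^*+BB^*)$, then $\gamma_1\le\gamma_2$ implies $\mu(\mathcal F(\gamma_1))\le\mu(\mathcal F(\gamma_2))$; conversely, $\mu(\mathcal F(\gamma_1))\le\mu(\mathcal F(\gamma_2))$ implies $\gamma_1\le\gamma_2$ provided that $\mu(\mathcal F(\gamma_1))>0$ and $\mu(\mathcal F(\gamma_2))<2\pi$; 7. if $\gamma>f(0,\theta)$ for some (equivalently, every) $\theta\in\mathbb R$, then $\mu(\mathcal F(\gamma))=2\pi$. -/

import Mathlib

open Real Set MeasureTheory Matrix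

noncomputable section

namespace DTU

/-- The linear control system `x' = A x + B u` is controllable: for every final time `T > 0`, every
initial state `x₀` and every final state `x₁`, some control function on `[0, T]` steers
`x₀` to `x₁`. -/
def IsControllable {n m : ℕ} (A : Matrix (Fin n) (Fin n) ℂ) (B : Matrix (Fin n) (Fin m) ℂ) : Prop :=
  ∀ T : ℝ, 0 < T → ∀ x₀ x₁ : Fin n → ℂ,
    ∃ (u : ℝ → Fin m → ℂ) (x : ℝ → Fin n → ℂ),
      ContinuousOn u (Icc 0 T) ∧
      (∀ t ∈ Icc 0 T, HasDerivWithinAt x (A *ᵥ x t + B *ᵥ u t) (Icc 0 T) t) ∧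
      x 0 = x₀ ∧ x T = x₁

open scoped Matrix.Norms.L2Operator in
/-- The distance to uncontrollability `τ(A, B)`: the distance, in the spectral norm of the
concatenated perturbation `[A - A', B - B']`, from `(A, B)` to the set of uncontrollable pairs. -/
def distUncontrollability {n m : ℕ} (A : Matrix (Fin n) (Fin n) ℂ)
    (B : Matrix (Fin n) (Fin m) ℂ) : ℝ :=
  sInf {d : ℝ | ∃ (A' : Matrix (Fin n) (Fin n) ℂ) (B' : Matrix (Fin n) (Fin m) ℂ),
    ¬ IsControllable A' B' ∧ d = ‖Matrix.fromCols (A - A') (B - B')‖}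

/-- The smallest of the `min p q` singular values of a `p × q` complex matrix (Mathlib lists the
singular values in descending order, starting at index `0`). -/
def sigmaMin {ι κ : Type*} [Fintype ι] [Fintype κ] [DecidableEq κ] (M : Matrix ι κ ℂ) : ℝ :=
  (Matrix.toEuclideanLin M).singularValues (min (Fintype.card ι) (Fintype.card κ) - 1)

/-- `f(r, θ) = σ_min([A - r e^{iθ} I, B])`. -/
def rayFun {n m : ℕ} (A : Matrix (Fin n) (Fin n) ℂ) (B : Matrix (Fin n) (Fin m) ℂ) (r θ : ℝ) : ℝ :=
  sigmaMin (Matrix.fromCols (A - ((r : ℂ) * Complex.exp (Complex.I * θ)) • 1) B)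

/-- The (finite) spectrum `Λ(M, N)` of the matrix pencil `M - z N`. -/
def pencilSpectrum {ι : Type*} [Fintype ι] [DecidableEq ι] (M N : Matrix ι ι ℂ) : Set ℂ :=
  {z | (M - z • N).det = 0}

/-- The characteristic polynomial `det(M - X N)` of the pencil `M - z N`. -/
def pencilPoly {ι : Type*} [Fintype ι] [DecidableEq ι] (M N : Matrix ι ι ℂ) : Polynomial ℂ :=
  (M.map Polynomial.C - (Polynomial.X : Polynomial ℂ) • N.map Polynomial.C).det

/-- `z` is a simple eigenvalue of the pencil `M - z N`: its algebraic multiplicity is one. -/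
def IsSimplePencilEigenvalue {ι : Type*} [Fintype ι] [DecidableEq ι] (M N : Matrix ι ι ℂ)
    (z : ℂ) : Prop :=
  (pencilPoly M N).rootMultiplicity z = 1

/-- The Hamiltonian matrix `C = [A, γ⁻¹ B B* - γ I; γ I, -A*]`. -/
def matC {n m : ℕ} (A : Matrix (Fin n) (Fin n) ℂ) (B : Matrix (Fin n) (Fin m) ℂ) (γ : ℝ) :
    Matrix (Fin n ⊕ Fin n) (Fin n ⊕ Fin n) ℂ :=
  Matrix.fromBlocks A (((γ : ℂ)⁻¹) • (B * Bᴴ) - (γ : ℂ) • 1) ((γ : ℂ) • 1) (-Aᴴ)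

/-- The skew-Hamiltonian matrix `D_θ = diag(-i e^{iθ} I, i e^{-iθ} I)`. -/
def matD (n : ℕ) (θ : ℝ) : Matrix (Fin n ⊕ Fin n) (Fin n ⊕ Fin n) ℂ :=
  Matrix.fromBlocks ((-(Complex.I * Complex.exp (Complex.I * θ))) • 1) 0 0
    ((Complex.I * Complex.exp (-(Complex.I * θ))) • 1)

/-- The eigenvalues of `(C, D_θ)` in the closed left half-plane. -/
def leftSpectrum {n m : ℕ} (A : Matrix (Fin n) (Fin n) ℂ) (B : Matrix (Fin n) (Fin m) ℂ)
    (γ θ : ℝ) : Set ℂ :=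
  {z | z ∈ pencilSpectrum (matC A B γ) (matD n θ) ∧ z.re ≤ 0}

/-- `Arg(-i z)²`, with the principal argument in `(-π, π]`. -/
def argSq (z : ℂ) : ℝ := Complex.arg (-Complex.I * z) ^ 2

/-- `f_γ(θ) = min {Arg(-i z)² : z ∈ Λ(C, D_θ), Re z ≤ 0}`. -/
def fGamma {n m : ℕ} (A : Matrix (Fin n) (Fin n) ℂ) (B : Matrix (Fin n) (Fin m) ℂ)
    (γ θ : ℝ) : ℝ :=
  sInf (argSq '' leftSpectrum A B γ θ)

/-- `ℱ(γ)`, the interior of the set of zeros of `f_γ` in `(-π, π]`. -/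
def zeroSet {n m : ℕ} (A : Matrix (Fin n) (Fin n) ℂ) (B : Matrix (Fin n) (Fin m) ℂ)
    (γ : ℝ) : Set ℝ :=
  interior {θ | θ ∈ Ioc (-π) π ∧ fGamma A B γ θ = 0}

/-- The standing condition on `γ`: `γ > 0` and `γ² ∉ Λ(A A* + B B*)`. -/
def Admissible {n m : ℕ} (A : Matrix (Fin n) (Fin n) ℂ) (B : Matrix (Fin n) (Fin m) ℂ)
    (γ : ℝ) : Prop :=
  0 < γ ∧ ((γ : ℂ) ^ 2) ∉ spectrum ℂ (A * Aᴴ + B * Bᴴ)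

end DTU

end

open Real Set MeasureTheory Matrix

noncomputable section

namespace DTU

variable {n m : ℕ}

/-! ### Spectrum of the skew-Hamiltonian/Hamiltonian pencil -/

section Pencil

/-! Since `D_θ` is invertible, the pencil has exactly `2n` eigenvalues with multiplicity, and they
are bounded uniformly in `θ`. Its structure makes the spectrum symmetric about the imaginary axis,
and `argSq` respects this symmetry, so `f_γ` is a minimum over the whole finite spectrum.
Eliminating one block shows that `i r` is an eigenvalue iff `γ` is a singular value of `[A - r
e^{iθ} I, B]`; admissibility thus means that `0` is never an eigenvalue. Continuity of `f_γ` follows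
from semicontinuity of the spectrum in both directions, differentiability from first-order implicit
differentiation of the determinant.

For the measure statements, singular values are replaced by unit vectors `v` with `‖[A - zI, B]ᴴ v‖
≤ γ`. These norms grow with `|z|`, so a ray that meets the sublevel set has a last radius in it,
where `γ` is exactly the smallest singular value (`exists_crossing`). Hence the zeros of `f_γ` are
the angles of rays meeting the punctured sublevel set (`fGamma_eq_zero_iff_exists`), which gives
monotonicity in `γ`. For the converse, if `γ₂ < γ₁`, the closed zero set for `γ₂` lies in the open
set of strict angles for `γ₁`; the measure inequality makes them equal, hence clopen in `ℝ`. The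
Hautus test links `τ(A, B)` to the sublevel set. -/

theorem eval_pencilPoly {ι : Type*} [Fintype ι] [DecidableEq ι] (M N : Matrix ι ι ℂ) (z : ℂ) :
    (pencilPoly M N).eval z = (M - z • N).det := by
  rw [pencilPoly, ← Polynomial.coe_evalRingHom, RingHom.map_det]
  congr 1
  ext i j
  simp
  exact mul_comm _ _

/-- The inverse of `D_θ`. -/
def matDInv (n : ℕ) (θ : ℝ) : Matrix (Fin n ⊕ Fin n) (Fin n ⊕ Fin n) ℂ :=
  Matrix.fromBlocks ((Complex.I * Complex.exp (-(Complex.I * θ))) • 1) 0 0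
    ((-(Complex.I * Complex.exp (Complex.I * θ))) • 1)

theorem matD_mul_matDInv (n : ℕ) (θ : ℝ) : matD n θ * matDInv n θ = 1 := by
  have h : Complex.exp (Complex.I * θ) * Complex.exp (-(Complex.I * θ)) = 1 := by
    rw [← Complex.exp_add]; simp
  have h1 : -(Complex.I * Complex.exp (Complex.I * θ)) *
      (Complex.I * Complex.exp (-(Complex.I * θ))) = 1 := by
    linear_combination (-Complex.I ^ 2) * h - Complex.I_sq
  have h2 : (Complex.I * Complex.exp (-(Complex.I * θ))) *
      -(Complex.I * Complex.exp (Complex.I * θ)) = 1 := by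
    rw [mul_comm]; exact h1
  rw [matD, matDInv, fromBlocks_multiply]
  simp only [smul_mul_smul_comm, h1, h2]
  simp

theorem det_neg_matD (n : ℕ) (θ : ℝ) : (-matD n θ).det = 1 := by
  have h : Complex.exp (Complex.I * θ) * Complex.exp (-(Complex.I * θ)) = 1 := by
    rw [← Complex.exp_add]; simp
  have h1 : -(Complex.I * Complex.exp (Complex.I * θ)) *
      (Complex.I * Complex.exp (-(Complex.I * θ))) = 1 := by
    linear_combination (-Complex.I ^ 2) * h - Complex.I_sq
  rw [det_neg, matD, det_fromBlocks_zero₂₁, det_smul, det_smul]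
  simp only [Fintype.card_sum, Fintype.card_fin, det_one, mul_one]
  rw [← mul_pow, h1, Even.neg_one_pow ⟨n, rfl⟩, one_pow, mul_one]

/-- `C - X D = (-D)(X - D⁻¹ C)` and `det (-D) = 1`; monicity and degree `2n` follow. -/
theorem pencilPoly_eq_charpoly (C : Matrix (Fin n ⊕ Fin n) (Fin n ⊕ Fin n) ℂ) (θ : ℝ) :
    pencilPoly C (matD n θ) = (matDInv n θ * C).charpoly := by
  have key : C.map Polynomial.C - (Polynomial.X : Polynomial ℂ) • (matD n θ).map Polynomial.C
      = (-matD n θ).map Polynomial.C * (matDInv n θ * C).charmatrix := by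
    have h1 : (matD n θ).map Polynomial.C * (matDInv n θ * C).map Polynomial.C
        = C.map Polynomial.C := by
      rw [← Matrix.map_mul, ← Matrix.mul_assoc, matD_mul_matDInv, Matrix.one_mul]
    rw [charmatrix, Matrix.mul_sub, RingHom.mapMatrix_apply]
    have h2 : (-matD n θ).map (Polynomial.C : ℂ →+* Polynomial ℂ)
        = -((matD n θ).map Polynomial.C) := by
      ext i j; simp
    rw [h2, Matrix.neg_mul _ ((matDInv n θ * C).map _), h1, Matrix.scalar_apply,
      ← smul_one_eq_diagonal, Matrix.mul_smul, Matrix.mul_one, smul_neg]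
    abel
  rw [pencilPoly, key, det_mul, Matrix.charpoly]
  have : ((-matD n θ).map (Polynomial.C : ℂ →+* Polynomial ℂ)).det = 1 := by
    have := RingHom.map_det (Polynomial.C : ℂ →+* Polynomial ℂ) (-matD n θ)
    rw [RingHom.mapMatrix_apply] at this
    rw [← this, det_neg_matD, map_one]
  rw [this, one_mul]

theorem monic_pencilPoly (C : Matrix (Fin n ⊕ Fin n) (Fin n ⊕ Fin n) ℂ) (θ : ℝ) :
    (pencilPoly C (matD n θ)).Monic := by
  rw [pencilPoly_eq_charpoly]; exact charpoly_monic _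

theorem natDegree_pencilPoly (C : Matrix (Fin n ⊕ Fin n) (Fin n ⊕ Fin n) ℂ) (θ : ℝ) :
    (pencilPoly C (matD n θ)).natDegree = n + n := by
  rw [pencilPoly_eq_charpoly, charpoly_natDegree_eq_dim]; simp

theorem mem_pencilSpectrum_iff (C : Matrix (Fin n ⊕ Fin n) (Fin n ⊕ Fin n) ℂ) (θ : ℝ) (z : ℂ) :
    z ∈ pencilSpectrum C (matD n θ) ↔ z ∈ (pencilPoly C (matD n θ)).roots := by
  rw [Polynomial.mem_roots (monic_pencilPoly C θ).ne_zero, Polynomial.IsRoot, eval_pencilPoly]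
  rfl

theorem finite_pencilSpectrum (C : Matrix (Fin n ⊕ Fin n) (Fin n ⊕ Fin n) ℂ) (θ : ℝ) :
    (pencilSpectrum C (matD n θ)).Finite := by
  refine ((pencilPoly C (matD n θ)).roots.toFinset.finite_toSet).subset fun z hz => ?_
  simpa using (mem_pencilSpectrum_iff C θ z).1 hz

theorem card_roots_pencilPoly (C : Matrix (Fin n ⊕ Fin n) (Fin n ⊕ Fin n) ℂ) (θ : ℝ) :
    (pencilPoly C (matD n θ)).roots.card = n + n := by
  rw [← natDegree_pencilPoly C θ]
  exact IsAlgClosed.card_roots_eq_natDegree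

theorem nonempty_pencilSpectrum (hn : 0 < n) (C : Matrix (Fin n ⊕ Fin n) (Fin n ⊕ Fin n) ℂ)
    (θ : ℝ) : (pencilSpectrum C (matD n θ)).Nonempty := by
  have h : 0 < (pencilPoly C (matD n θ)).roots.card := by rw [card_roots_pencilPoly]; omega
  obtain ⟨z, hz⟩ := Multiset.card_pos_iff_exists_mem.1 h
  exact ⟨z, (mem_pencilSpectrum_iff C θ z).2 hz⟩

theorem J_mul_matC_isHermitian (A : Matrix (Fin n) (Fin n) ℂ) (B : Matrix (Fin n) (Fin m) ℂ)
    (γ : ℝ) : (J (Fin n) ℂ * matC A B γ)ᴴ = J (Fin n) ℂ * matC A B γ := by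
  rw [J, matC, fromBlocks_multiply, fromBlocks_conjTranspose]
  simp [conjTranspose_smul, conjTranspose_mul]

theorem J_mul_matD_isSkewHermitian (θ : ℝ) :
    (J (Fin n) ℂ * matD n θ)ᴴ = -(J (Fin n) ℂ * matD n θ) := by
  rw [J, matD, fromBlocks_multiply, fromBlocks_conjTranspose, fromBlocks_neg]
  simp [conjTranspose_smul, ← Complex.exp_conj]

/-- `J C` is Hermitian and `J D` skew-Hermitian, so the adjoint of `J (C - z D)` is `J (C + z̄ D)`.
-/
theorem neg_conj_mem_pencilSpectrum {A : Matrix (Fin n) (Fin n) ℂ} {B : Matrix (Fin n) (Fin m) ℂ}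
    {γ θ : ℝ} {z : ℂ} (hz : z ∈ pencilSpectrum (matC A B γ) (matD n θ)) :
    -(starRingEnd ℂ z) ∈ pencilSpectrum (matC A B γ) (matD n θ) := by
  have hJ : (J (Fin n) ℂ).det ≠ 0 := (isUnit_det_J (Fin n) ℂ).ne_zero
  have h1 : (J (Fin n) ℂ * (matC A B γ - z • matD n θ))ᴴ
      = J (Fin n) ℂ * (matC A B γ - (-(starRingEnd ℂ z)) • matD n θ) := by
    rw [Matrix.mul_sub, Matrix.mul_sub, conjTranspose_sub, J_mul_matC_isHermitian,
      Matrix.mul_smul, Matrix.mul_smul, conjTranspose_smul, J_mul_matD_isSkewHermitian]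
    simp
  have h2 := congrArg det h1
  have hz' : (matC A B γ - z • matD n θ).det = 0 := hz
  rw [det_conjTranspose, det_mul, det_mul, hz', mul_zero, star_zero] at h2
  exact (mul_eq_zero.1 h2.symm).resolve_left hJ

/-- Reflection in the imaginary axis conjugates `-i z`. This flips the sign of the argument, except
that the value `π` is kept; the square is unaffected. -/
theorem argSq_neg_conj (z : ℂ) : argSq (-(starRingEnd ℂ z)) = argSq z := by
  have h : -Complex.I * -(starRingEnd ℂ z) = starRingEnd ℂ (-Complex.I * z) := by simp
  rw [argSq, argSq, h, Complex.arg_conj]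
  split_ifs with h1
  · rw [h1]
  · ring

theorem argSq_image_leftSpectrum (A : Matrix (Fin n) (Fin n) ℂ) (B : Matrix (Fin n) (Fin m) ℂ)
    (γ θ : ℝ) :
    argSq '' leftSpectrum A B γ θ = argSq '' pencilSpectrum (matC A B γ) (matD n θ) := by
  apply Subset.antisymm (image_mono fun z hz => hz.1)
  rintro _ ⟨z, hz, rfl⟩
  rcases le_total z.re 0 with h | h
  · exact ⟨z, ⟨hz, h⟩, rfl⟩
  · exact ⟨_, ⟨neg_conj_mem_pencilSpectrum hz, by simpa using h⟩, argSq_neg_conj z⟩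

theorem isLeast_fGamma (hn : 0 < n) (A : Matrix (Fin n) (Fin n) ℂ) (B : Matrix (Fin n) (Fin m) ℂ)
    (γ θ : ℝ) : IsLeast (argSq '' leftSpectrum A B γ θ) (fGamma A B γ θ) := by
  rw [fGamma, argSq_image_leftSpectrum]
  have hf : (argSq '' pencilSpectrum (matC A B γ) (matD n θ)).Finite :=
    (finite_pencilSpectrum _ _).image _
  have hne := (nonempty_pencilSpectrum hn (matC A B γ) θ).image argSq
  exact ⟨hne.csInf_mem hf, fun x hx => csInf_le hf.bddBelow hx⟩

theorem fGamma_nonneg (hn : 0 < n) (A : Matrix (Fin n) (Fin n) ℂ) (B : Matrix (Fin n) (Fin m) ℂ)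
    (γ θ : ℝ) : 0 ≤ fGamma A B γ θ := by
  obtain ⟨z, -, hz⟩ := (isLeast_fGamma hn A B γ θ).1
  rw [← hz]; exact sq_nonneg _

theorem fGamma_le (hn : 0 < n) {A : Matrix (Fin n) (Fin n) ℂ} {B : Matrix (Fin n) (Fin m) ℂ}
    {γ θ : ℝ} {z : ℂ} (hz : z ∈ pencilSpectrum (matC A B γ) (matD n θ)) :
    fGamma A B γ θ ≤ argSq z := by
  have := (isLeast_fGamma hn A B γ θ).2
  rw [argSq_image_leftSpectrum] at this
  exact this ⟨z, hz, rfl⟩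

/-- The pencil `C - i r D_θ` is singular iff `γ` is a singular value of `[A - r e^{iθ} I, B]`. -/
theorem I_mul_mem_pencilSpectrum_iff (A : Matrix (Fin n) (Fin n) ℂ) (B : Matrix (Fin n) (Fin m) ℂ)
    {γ : ℝ} (hγ : 0 < γ) (r θ : ℝ) :
    Complex.I * (r : ℂ) ∈ pencilSpectrum (matC A B γ) (matD n θ) ↔
      ∃ y : Fin n → ℂ, y ≠ 0 ∧
        ((A - ((r : ℂ) * Complex.exp (Complex.I * θ)) • 1) *
          (A - ((r : ℂ) * Complex.exp (Complex.I * θ)) • 1)ᴴ + B * Bᴴ) *ᵥ y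
          = ((γ : ℂ) ^ 2) • y := by
  set X := A - ((r : ℂ) * Complex.exp (Complex.I * θ)) • (1 : Matrix (Fin n) (Fin n) ℂ) with hX
  have hγ' : (γ : ℂ) ≠ 0 := by exact_mod_cast hγ.ne'
  have hblock : matC A B γ - (Complex.I * (r : ℂ)) • matD n θ
      = fromBlocks X ((γ : ℂ)⁻¹ • (B * Bᴴ) - (γ : ℂ) • 1) ((γ : ℂ) • 1) (-Xᴴ) := by
    have hI := Complex.I_mul_I
    rw [matC, matD, fromBlocks_smul, sub_eq_add_neg, fromBlocks_neg, fromBlocks_add, hX]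
    congr 1
    · rw [smul_smul, sub_eq_add_neg, ← neg_smul, ← neg_smul]
      congr 2
      linear_combination ((r : ℂ) * Complex.exp (Complex.I * θ)) * hI
    · simp
    · simp
    · rw [smul_smul, conjTranspose_sub, conjTranspose_smul, conjTranspose_one, neg_sub,
        sub_eq_add_neg, add_comm, ← neg_smul]
      congr 2
      simp only [star_mul', RCLike.star_def, Complex.conj_ofReal, ← Complex.exp_conj, map_mul,
        Complex.conj_I, neg_mul]
      linear_combination (-(r : ℂ) * Complex.exp (-(Complex.I * θ))) * hI
  have hiff : Complex.I * (r : ℂ) ∈ pencilSpectrum (matC A B γ) (matD n θ) ↔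
      ∃ v : Fin n ⊕ Fin n → ℂ, v ≠ 0 ∧
      (fromBlocks X ((γ : ℂ)⁻¹ • (B * Bᴴ) - (γ : ℂ) • 1) ((γ : ℂ) • 1) (-Xᴴ)) *ᵥ v = 0 := by
    rw [← hblock]; exact (exists_mulVec_eq_zero_iff).symm
  rw [hiff]
  constructor
  · rintro ⟨v, hv, h⟩
    obtain ⟨x, y, rfl⟩ : ∃ x y : Fin n → ℂ, v = Sum.elim x y :=
      ⟨v ∘ Sum.inl, v ∘ Sum.inr, (Sum.elim_comp_inl_inr v).symm⟩
    rw [fromBlocks_mulVec] at h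
    have h1 := congrArg (· ∘ Sum.inl) h
    have h2 := congrArg (· ∘ Sum.inr) h
    simp only [Sum.elim_comp_inl, Sum.elim_comp_inr, Pi.zero_comp, smul_mulVec, one_mulVec,
      sub_mulVec, neg_mulVec] at h1 h2
    -- The lower block row determines `x` from `y`; substituting it in the upper row leaves the
    -- eigenvalue equation.
    have h3 : Xᴴ *ᵥ y = (γ : ℂ) • x := (add_neg_eq_zero.1 h2).symm
    refine ⟨y, ?_, ?_⟩
    · rintro rfl
      rw [mulVec_zero] at h3
      have hx : x = 0 := (smul_eq_zero.1 h3.symm).resolve_left hγ'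
      exact hv (by rw [hx]; ext (i | i) <;> rfl)
    · have h4 := congrArg (fun w => (γ : ℂ) • w) h1
      simp only [smul_add, smul_sub, smul_smul, mul_inv_cancel₀ hγ', one_smul, smul_zero] at h4
      rw [add_mulVec, ← mulVec_mulVec, h3, mulVec_smul, pow_two]
      rw [← sub_eq_zero, ← h4]; abel
  · rintro ⟨y, hy, h⟩
    refine ⟨Sum.elim ((γ : ℂ)⁻¹ • (Xᴴ *ᵥ y)) y, ?_, ?_⟩
    · intro h0
      exact hy (by simpa using congrArg (· ∘ Sum.inr) h0)
    · rw [fromBlocks_mulVec]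
      simp only [Sum.elim_comp_inl, Sum.elim_comp_inr, smul_mulVec, one_mulVec,
        sub_mulVec, neg_mulVec, mulVec_smul, smul_smul, inv_mul_cancel₀ hγ', one_smul,
        add_neg_cancel]
      rw [add_mulVec, ← mulVec_mulVec] at h
      have : (γ : ℂ)⁻¹ • X *ᵥ Xᴴ *ᵥ y + ((γ : ℂ)⁻¹ • (B * Bᴴ) *ᵥ y - (γ : ℂ) • y) = 0 := by
        rw [← add_sub_assoc, ← smul_add, h, smul_smul, pow_two, inv_mul_cancel_left₀ hγ', sub_self]
      rw [this]
      ext (i | i) <;> rfl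

/-- At `r = 0` the singular-value criterion loses `θ` and becomes the excluded case `γ² ∈ Λ(A A* + B
B*)`. -/
theorem zero_notMem_pencilSpectrum {A : Matrix (Fin n) (Fin n) ℂ} {B : Matrix (Fin n) (Fin m) ℂ}
    {γ : ℝ} (h : Admissible A B γ) (θ : ℝ) : 0 ∉ pencilSpectrum (matC A B γ) (matD n θ) := by
  intro h0
  have h1 : Complex.I * ((0 : ℝ) : ℂ) ∈ pencilSpectrum (matC A B γ) (matD n θ) := by simpa using h0
  obtain ⟨y, hy, hyy⟩ := (I_mul_mem_pencilSpectrum_iff A B h.1 0 θ).1 h1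
  simp only [Complex.ofReal_zero, zero_mul, zero_smul, sub_zero] at hyy
  apply h.2
  rw [← Matrix.spectrum_toLin', ← Module.End.hasEigenvalue_iff_mem_spectrum]
  exact Module.End.hasEigenvalue_of_hasEigenvector
    ⟨Module.End.mem_eigenspace_iff.2 (by rwa [toLin'_apply]), hy⟩

theorem fGamma_eq_zero_iff (hn : 0 < n) {A : Matrix (Fin n) (Fin n) ℂ}
    {B : Matrix (Fin n) (Fin m) ℂ} {γ : ℝ} (h : Admissible A B γ) (θ : ℝ) :
    fGamma A B γ θ = 0 ↔ ∃ r : ℝ, 0 < r ∧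
      Complex.I * (r : ℂ) ∈ pencilSpectrum (matC A B γ) (matD n θ) := by
  constructor
  · intro h0
    obtain ⟨z, hz, hz0⟩ := (isLeast_fGamma hn A B γ θ).1
    rw [h0, argSq, sq_eq_zero_iff, Complex.arg_eq_zero_iff] at hz0
    have hz1 : z = Complex.I * ((-Complex.I * z).re : ℂ) := by
      have : (((-Complex.I * z).re : ℝ) : ℂ) = -Complex.I * z := by
        apply Complex.ext <;> simp
        simpa using hz0.2.symm
      rw [this, ← mul_assoc]; simp
    -- As `Complex.arg 0 = 0`, a vanishing argument only gives `r ≥ 0`; admissibility rules out `r =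
    -- 0`.
    refine ⟨(-Complex.I * z).re, lt_of_le_of_ne hz0.1 fun h1 => ?_, hz1 ▸ hz.1⟩
    rw [← h1] at hz1
    exact zero_notMem_pencilSpectrum h θ (by simpa [hz1] using hz.1)
  · rintro ⟨r, hr, hz⟩
    apply le_antisymm _ (fGamma_nonneg hn A B γ θ)
    refine (fGamma_le hn hz).trans_eq ?_
    have : -Complex.I * (Complex.I * (r : ℂ)) = r := by rw [← mul_assoc]; simp
    rw [argSq, this, Complex.arg_ofReal_of_nonneg hr.le]; simp

end Pencil

/-! ### Continuity of the spectrum and of `f_γ` -/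

section Spectrum

open Filter Topology

/-- The jump of `arg` across the negative axis disappears on squaring: the result is the squared
unoriented angle with `1`. -/
theorem continuousAt_argSq {z : ℂ} (hz : z ≠ 0) : ContinuousAt argSq z := by
  have hne : ∀ w : ℂ, w ≠ 0 → -Complex.I * w ≠ 0 := fun w hw =>
    mul_ne_zero (neg_ne_zero.2 Complex.I_ne_zero) hw
  have h1 : ContinuousAt (fun w : ℂ => InnerProductGeometry.angle (1 : ℂ) (-Complex.I * w) ^ 2) z := by
    have h := InnerProductGeometry.continuousAt_angle (x := ((1 : ℂ), -Complex.I * z))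
      one_ne_zero (hne z hz)
    have h2 : ContinuousAt (fun w : ℂ => ((1 : ℂ), -Complex.I * w)) z := by fun_prop
    exact (ContinuousAt.comp (f := fun w : ℂ => ((1 : ℂ), -Complex.I * w)) h h2).pow 2
  refine h1.congr ?_
  filter_upwards [isOpen_ne.mem_nhds hz] with w hw
  rw [Complex.angle_one_left (hne w hw), sq_abs, argSq]

theorem contDiff_det_pencil (C : Matrix (Fin n ⊕ Fin n) (Fin n ⊕ Fin n) ℂ) :
    ContDiff ℝ 1 (fun x : ℝ × ℂ => (C - x.2 • matD n x.1).det) := by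
  have hof : ContDiff ℝ 1 (fun x : ℝ × ℂ => (x.1 : ℂ)) :=
    Complex.ofRealCLM.contDiff.comp contDiff_fst
  have hentry : ∀ i j, ContDiff ℝ 1 (fun x : ℝ × ℂ => (C - x.2 • matD n x.1) i j) := by
    intro i j
    have hD : ContDiff ℝ 1 (fun x : ℝ × ℂ => matD n x.1 i j) := by
      rcases i with i | i <;> rcases j with j | j <;>
        simp only [matD, fromBlocks_apply₁₁, fromBlocks_apply₁₂, fromBlocks_apply₂₁,
          fromBlocks_apply₂₂, Matrix.smul_apply, Matrix.zero_apply, smul_eq_mul] <;> fun_prop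
    simp only [Matrix.sub_apply, Matrix.smul_apply, smul_eq_mul]
    fun_prop
  simp only [det_apply']
  refine ContDiff.sum fun σ _ => contDiff_const.mul ?_
  exact contDiff_prod fun i _ => hentry _ _

/-- `D_θ` is diagonal with unimodular entries, so it preserves the sup norm and `C v = z D_θ v`
gives `|z| ≤ ‖C‖`. -/
theorem norm_le_of_mem_pencilSpectrum (C : Matrix (Fin n ⊕ Fin n) (Fin n ⊕ Fin n) ℂ) :
    ∃ K : ℝ, ∀ θ : ℝ, ∀ z ∈ pencilSpectrum C (matD n θ), ‖z‖ ≤ K := by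
  refine ⟨‖LinearMap.toContinuousLinearMap (Matrix.toLin' C)‖, fun θ z hz => ?_⟩
  have hz' : (C - z • matD n θ).det = 0 := hz
  obtain ⟨v, hv, h⟩ := exists_mulVec_eq_zero_iff.2 hz'
  rw [sub_mulVec, sub_eq_zero, smul_mulVec] at h
  have h1 : ‖matD n θ *ᵥ v‖ = ‖v‖ := by
    have hI : ∀ t : ℝ, ‖Complex.exp (Complex.I * t)‖ = 1 := fun t => by
      rw [mul_comm]; exact Complex.norm_exp_ofReal_mul_I t
    have hi : ∀ i, ‖(matD n θ *ᵥ v) i‖ = ‖v i‖ := by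
      have h2 := hI (-θ)
      simp only [Complex.ofReal_neg, mul_neg] at h2
      intro i
      rw [matD, fromBlocks_mulVec]
      rcases i with i | i <;> simp [neg_mulVec, smul_mulVec, hI θ, h2]
    simp only [Pi.norm_def]
    congr 2
    ext i
    exact hi i
  have h2 := (LinearMap.toContinuousLinearMap (Matrix.toLin' C)).le_opNorm v
  have h3 : (LinearMap.toContinuousLinearMap (Matrix.toLin' C)) v = C *ᵥ v := by simp
  rw [h3, h, norm_smul, h1] at h2
  exact le_of_mul_le_mul_right h2 (norm_pos_iff.2 hv)

/-- Upper hemicontinuity of the spectrum of the pencil. -/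
theorem eventually_forall_mem_pencilSpectrum (C : Matrix (Fin n ⊕ Fin n) (Fin n ⊕ Fin n) ℂ)
    {θ₀ : ℝ} {Q : ℝ → ℂ → Prop}
    (hQ : ∀ z ∈ pencilSpectrum C (matD n θ₀), ∀ᶠ x : ℝ × ℂ in 𝓝 (θ₀, z), Q x.1 x.2) :
    ∀ᶠ θ in 𝓝 θ₀, ∀ z ∈ pencilSpectrum C (matD n θ), Q θ z := by
  obtain ⟨K, hK⟩ := norm_le_of_mem_pencilSpectrum C
  -- All eigenvalues lie in one compact ball, so neighbourhoods of the points `(θ₀, z)` yield one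
  -- neighbourhood of `θ₀`.
  have h := (isCompact_closedBall (0 : ℂ) K).eventually_forall_of_forall_eventually (x₀ := θ₀)
    (P := fun θ z => z ∈ pencilSpectrum C (matD n θ) → Q θ z) ?_
  · filter_upwards [h] with θ hθ z hz
    exact hθ z (by simpa using hK θ z hz) hz
  · intro z _
    by_cases hz : z ∈ pencilSpectrum C (matD n θ₀)
    · filter_upwards [hQ z hz] with x hx _ using hx
    · have hc := (contDiff_det_pencil C).continuous.continuousAt (x := (θ₀, z))
      filter_upwards [hc.eventually_ne hz] with x hx hx'
      exact absurd hx' hx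

/-- Lower hemicontinuity of the spectrum of the pencil. -/
theorem eventually_exists_mem_pencilSpectrum (C : Matrix (Fin n ⊕ Fin n) (Fin n ⊕ Fin n) ℂ)
    {θ₀ : ℝ} {z₀ : ℂ} (hz₀ : z₀ ∈ pencilSpectrum C (matD n θ₀)) {s : Set ℂ} (hs : s ∈ 𝓝 z₀) :
    ∀ᶠ θ in 𝓝 θ₀, ∃ z ∈ pencilSpectrum C (matD n θ), z ∈ s := by
  obtain ⟨ε, hε, hs⟩ := Metric.mem_nhds_iff.1 hs
  have hc : ContinuousAt (fun θ : ℝ => (C - z₀ • matD n θ).det) θ₀ :=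
    ((contDiff_det_pencil C).continuous.comp
      (continuous_id.prodMk continuous_const : Continuous fun θ : ℝ => (θ, z₀))).continuousAt
  have hz0 : (C - z₀ • matD n θ₀).det = 0 := hz₀
  -- A monic polynomial of degree `n + n` whose roots all have distance at least `ε` from `z₀` has
  -- modulus at least `ε ^ (n + n)` there.
  have hev : ∀ᶠ θ in 𝓝 θ₀, ‖(C - z₀ • matD n θ).det‖ < ε ^ (n + n) := by
    refine hc.norm.eventually_lt continuousAt_const ?_
    rw [hz0, norm_zero]; positivity
  filter_upwards [hev] with θ hθ
  by_contra! hcon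
  refine absurd hθ (not_lt.2 ?_)
  rw [← eval_pencilPoly, (IsAlgClosed.splits (pencilPoly C (matD n θ))).eval_eq_prod_roots_of_monic
    (monic_pencilPoly C θ), ← card_roots_pencilPoly C θ]
  have hall : ∀ w ∈ (pencilPoly C (matD n θ)).roots, ε ≤ ‖z₀ - w‖ := by
    intro w hw
    by_contra! h
    refine hcon w ((mem_pencilSpectrum_iff C θ w).2 hw) (hs ?_)
    rwa [Metric.mem_ball, dist_comm, dist_eq_norm]
  generalize (pencilPoly C (matD n θ)).roots = R at hall
  induction R using Multiset.induction_on with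
  | empty => simp
  | cons a R ih =>
    rw [Multiset.map_cons, Multiset.prod_cons, norm_mul, Multiset.card_cons, pow_succ']
    exact mul_le_mul (hall a (Multiset.mem_cons_self a R))
      (ih fun w hw => hall w (Multiset.mem_cons_of_mem hw)) (by positivity) (norm_nonneg _)

theorem continuous_fGamma (hn : 0 < n) {A : Matrix (Fin n) (Fin n) ℂ}
    {B : Matrix (Fin n) (Fin m) ℂ} {γ : ℝ} (h : Admissible A B γ) :
    Continuous (fGamma A B γ) := by
  rw [continuous_iff_continuousAt]
  intro θ₀
  have hne : ∀ z ∈ pencilSpectrum (matC A B γ) (matD n θ₀), z ≠ 0 := by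
    rintro z hz rfl
    exact zero_notMem_pencilSpectrum h θ₀ hz
  rw [ContinuousAt, tendsto_order]
  constructor
  · intro a ha
    have := eventually_forall_mem_pencilSpectrum (matC A B γ) (θ₀ := θ₀)
      (Q := fun _ z => a < argSq z) fun z hz => by
        have h1 : ContinuousAt (fun x : ℝ × ℂ => argSq x.2) (θ₀, z) :=
          ContinuousAt.comp (f := Prod.snd) (continuousAt_argSq (hne z hz)) continuousAt_snd
        exact h1.eventually_const_lt (ha.trans_le (fGamma_le hn hz))
    filter_upwards [this] with θ hθ
    obtain ⟨z, hz, hz0⟩ := (isLeast_fGamma hn A B γ θ).1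
    rw [← hz0]
    exact hθ z hz.1
  · intro a ha
    obtain ⟨z, hz, hz0⟩ := (isLeast_fGamma hn A B γ θ₀).1
    rw [← hz0] at ha
    have := eventually_exists_mem_pencilSpectrum (matC A B γ) hz.1
      ((continuousAt_argSq (hne z hz.1)).eventually_lt_const ha)
    filter_upwards [this] with θ ⟨w, hw, hwa⟩
    exact (fGamma_le hn hw).trans_lt hwa

end Spectrum

/-! ### Differentiability at a unique simple minimiser -/

section Differentiability

open Filter Topology Asymptotics

/-- A continuous selection of zeros of `F t` is differentiable at a point where the derivative of
`F` in the complex variable does not vanish. -/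
theorem differentiableAt_of_isZero {F : ℝ × ℂ → ℂ} {a : ℝ} {z : ℝ → ℂ} {d : ℂ}
    (hF : DifferentiableAt ℝ F (a, z a)) (hd : HasDerivAt (fun w => F (a, w)) d (z a)) (hd0 : d ≠ 0)
    (hz : ContinuousAt z a) (h0 : F (a, z a) = 0) (h : ∀ᶠ t in 𝓝 a, F (t, z t) = 0) :
    DifferentiableAt ℝ z a := by
  obtain ⟨L, hL⟩ := hF
  have hLw : ∀ w : ℂ, L (0, w) = d * w := by
    have h1 : HasFDerivAt (fun w : ℂ => F (a, w)) (L.comp (ContinuousLinearMap.inr ℝ ℝ ℂ)) (z a) :=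
      HasFDerivAt.comp (z a) hL (hasFDerivAt_prodMk_right a (z a))
    have h2 := h1.unique (hd.hasFDerivAt.restrictScalars ℝ)
    intro w
    have := congrArg (fun T : ℂ →L[ℝ] ℂ => T w) h2
    simpa [mul_comm] using this
  set q := L (1, 0) with hq
  have hLt : ∀ (t : ℝ) (w : ℂ), L (t, w) = (t : ℂ) * q + d * w := by
    intro t w
    have : ((t, w) : ℝ × ℂ) = t • (1, 0) + (0, w) := by simp
    rw [this, map_add, map_smul, hLw, Complex.real_smul]
  have hg : Tendsto (fun t => (t, z t)) (𝓝 a) (𝓝 (a, z a)) := continuousAt_id.prodMk hz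
  have ho := (hL.isLittleO).comp_tendsto hg
  -- The expansion `0 = (t - a) q + d (z t - z a) + o(·)`, divided by `d`.
  have ho1 : (fun t => (z t - z a) + ((t - a : ℝ) : ℂ) * (q / d))
      =o[𝓝 a] (fun t => ((t - a : ℝ), z t - z a)) := by
    have h1 := ho.const_mul_left (-d⁻¹)
    refine h1.congr' ?_ (Eventually.of_forall fun t => rfl)
    filter_upwards [h] with t ht
    have : ((t, z t) : ℝ × ℂ) - (a, z a) = (t - a, z t - z a) := rfl
    simp only [Function.comp_apply, ht, h0, this, hLt]
    field_simp
    ring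
  have hO : (fun t => ((t - a : ℝ), z t - z a)) =O[𝓝 a] (fun t => t - a) := by
    refine (isBigO_refl _ _).prod_left ?_
    -- With constant `1/2`, the term `‖z t - z a‖` on the right is absorbed on the left, at the
    -- price of the factor `2`.
    have hb := ho1.bound (show (0 : ℝ) < 1 / 2 by norm_num)
    refine IsBigO.of_bound (1 + 2 * ‖q / d‖) ?_
    filter_upwards [hb] with t ht
    have h3 : ‖(((t - a : ℝ), z t - z a) : ℝ × ℂ)‖ ≤ ‖t - a‖ + ‖z t - z a‖ := by
      rw [Prod.norm_def]
      exact max_le_add_of_nonneg (norm_nonneg _) (norm_nonneg _)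
    have h4 : ‖z t - z a‖ ≤ ‖(z t - z a) + ((t - a : ℝ) : ℂ) * (q / d)‖
        + ‖((t - a : ℝ) : ℂ) * (q / d)‖ := by
      simpa using norm_sub_le ((z t - z a) + ((t - a : ℝ) : ℂ) * (q / d))
        (((t - a : ℝ) : ℂ) * (q / d))
    rw [norm_mul, Complex.norm_real] at h4
    nlinarith
  have hder : HasDerivAt z (-(q / d)) a := by
    rw [hasDerivAt_iff_isLittleO]
    refine (ho1.trans_isBigO hO).congr' (Eventually.of_forall fun t => ?_) (EventuallyEq.refl _ _)
    simp only [Complex.real_smul]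
    ring
  exact hder.differentiableAt

theorem differentiableAt_argSq {z : ℂ} (hz : -Complex.I * z ∈ Complex.slitPlane) :
    DifferentiableAt ℝ argSq z := by
  have h1 : DifferentiableAt ℝ Complex.arg (-Complex.I * z) := by
    have h2 : DifferentiableAt ℝ (fun w : ℂ => (Complex.log w).im) (-Complex.I * z) :=
      (Complex.imCLM.differentiableAt).comp _
        ((Complex.differentiableAt_log hz).restrictScalars ℝ)
    simpa only [Complex.log_im] using h2
  have h3 : DifferentiableAt ℝ (fun w : ℂ => -Complex.I * w) z := by fun_prop
  exact (DifferentiableAt.comp z h1 h3).pow 2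

/-- On the branch cut the minimum would equal the largest possible value `π²`, so every eigenvalue
would attain it. Uniqueness and reflection then force all `2n` roots to coincide, contradicting
multiplicity one. -/
theorem mem_slitPlane_of_isSimple {A : Matrix (Fin n) (Fin n) ℂ} {B : Matrix (Fin n) (Fin m) ℂ}
    (hn : 0 < n) {γ θ : ℝ} (h : Admissible A B γ) {z : ℂ} (hz : z ∈ leftSpectrum A B γ θ)
    (hmin : argSq z = fGamma A B γ θ)
    (huniq : ∀ w ∈ leftSpectrum A B γ θ, argSq w = fGamma A B γ θ → w = z)
    (hsimple : IsSimplePencilEigenvalue (matC A B γ) (matD n θ) z) :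
    -Complex.I * z ∈ Complex.slitPlane := by
  have hz0 : z ≠ 0 := by
    rintro rfl
    exact zero_notMem_pencilSpectrum h θ hz.1
  rw [Complex.mem_slitPlane_iff_arg]
  refine ⟨fun harg => ?_, mul_ne_zero (neg_ne_zero.2 Complex.I_ne_zero) hz0⟩
  have hpi : argSq z = π ^ 2 := by rw [argSq, harg]
  have hle : ∀ w : ℂ, argSq w ≤ π ^ 2 := fun w => by
    rw [argSq, ← sq_abs]
    exact pow_le_pow_left₀ (abs_nonneg _) (Complex.abs_arg_le_pi _) 2
  have hmax : ∀ w ∈ pencilSpectrum (matC A B γ) (matD n θ), argSq w = fGamma A B γ θ :=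
    fun w hw => le_antisymm ((hle w).trans_eq (hpi.symm.trans hmin)) (fGamma_le hn hw)
  have hre : z.re = 0 := by
    rw [Complex.arg_eq_pi_iff] at harg
    simpa using harg.2
  have hall : ∀ w ∈ (pencilPoly (matC A B γ) (matD n θ)).roots, w = z := by
    intro w hw
    have hw' := (mem_pencilSpectrum_iff _ _ _).2 hw
    rcases le_total w.re 0 with hr | hr
    · exact huniq w ⟨hw', hr⟩ (hmax w hw')
    · have hc := neg_conj_mem_pencilSpectrum hw'
      have h1 := huniq _ ⟨hc, by simpa using hr⟩ (hmax _ hc)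
      have h2 : w.re = 0 := by
        have := congrArg Complex.re h1
        simpa [hre] using this
      exact huniq w ⟨hw', h2.le⟩ (hmax w hw')
  have hcard := card_roots_pencilPoly (matC A B γ) θ
  have h1 : (pencilPoly (matC A B γ) (matD n θ)).roots.count z = 1 := by
    rw [Polynomial.count_roots]; exact hsimple
  rw [Multiset.count_eq_card.2 fun w hw => (hall w hw).symm, hcard] at h1
  omega

theorem differentiableAt_fGamma (hn : 0 < n) {A : Matrix (Fin n) (Fin n) ℂ}
    {B : Matrix (Fin n) (Fin m) ℂ} {γ θ₀ : ℝ} (h : Admissible A B γ) {z₀ : ℂ}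
    (hz₀ : z₀ ∈ leftSpectrum A B γ θ₀) (hmin : argSq z₀ = fGamma A B γ θ₀)
    (huniq : ∀ w ∈ leftSpectrum A B γ θ₀, argSq w = fGamma A B γ θ₀ → w = z₀)
    (hsimple : IsSimplePencilEigenvalue (matC A B γ) (matD n θ₀) z₀) :
    DifferentiableAt ℝ (fGamma A B γ) θ₀ := by
  -- Any choice of minimisers works: uniqueness at `θ₀` forces continuity there.
  choose z hz hzmin using fun θ => (isLeast_fGamma hn A B γ θ).1
  have hzz : z θ₀ = z₀ := huniq _ (hz θ₀) (hzmin θ₀)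
  have hslit := mem_slitPlane_of_isSimple hn h hz₀ hmin huniq hsimple
  have hcont : ContinuousAt z θ₀ := by
    rw [Metric.continuousAt_iff']
    intro ε hε
    have hev := eventually_forall_mem_pencilSpectrum (matC A B γ) (θ₀ := θ₀)
      -- Every eigenvalue near `θ₀` is close to `z₀`, in the open right half-plane, or not minimal;
      -- `z θ` can only be the first.
      (Q := fun θ w => dist w z₀ < ε ∨ 0 < w.re ∨ fGamma A B γ θ < argSq w) fun w hw => by
        by_cases hw0 : w = z₀
        · subst hw0
          have hc : ContinuousAt (fun x : ℝ × ℂ => dist x.2 w) (θ₀, w) := by fun_prop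
          filter_upwards [hc.eventually_lt_const (show dist w w < ε by simpa using hε)] with x hx
          exact Or.inl hx
        rcases lt_or_ge 0 w.re with hr | hr
        · have hc : ContinuousAt (fun x : ℝ × ℂ => x.2.re) (θ₀, w) := by fun_prop
          filter_upwards [hc.eventually_const_lt (show 0 < w.re from hr)] with x hx
          exact Or.inr (Or.inl hx)
        · have hwne : w ≠ 0 := by
            rintro rfl
            exact zero_notMem_pencilSpectrum h θ₀ hw
          have hlt : fGamma A B γ θ₀ < argSq w :=
            lt_of_le_of_ne (fGamma_le hn hw) fun he => hw0 (huniq w ⟨hw, hr⟩ he.symm)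
          have h1 : ContinuousAt (fun x : ℝ × ℂ => argSq x.2) (θ₀, w) :=
            ContinuousAt.comp (f := Prod.snd) (continuousAt_argSq hwne) continuousAt_snd
          have h2 : ContinuousAt (fun x : ℝ × ℂ => fGamma A B γ x.1) (θ₀, w) :=
            ((continuous_fGamma hn h).comp continuous_fst).continuousAt
          filter_upwards [h2.eventually_lt h1 hlt] with x hx
          exact Or.inr (Or.inr hx)
    filter_upwards [hev] with θ hθ
    rw [hzz]
    rcases hθ (z θ) (hz θ).1 with h1 | h1 | h1
    · exact h1
    · exact absurd h1 (not_lt.2 (hz θ).2)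
    · exact absurd h1 (hzmin θ).le.not_gt
  have hdz : DifferentiableAt ℝ z θ₀ := by
    refine differentiableAt_of_isZero (F := fun x => (matC A B γ - x.2 • matD n x.1).det)
      (d := (Polynomial.derivative (pencilPoly (matC A B γ) (matD n θ₀))).eval z₀)
      ((contDiff_det_pencil _).differentiable one_ne_zero _) ?_ ?_ hcont (hz θ₀).1
      (Eventually.of_forall fun θ => (hz θ).1)
    · simp only [← eval_pencilPoly, hzz]
      exact Polynomial.hasDerivAt _ _
    · intro hd
      have h2 := (Polynomial.one_lt_rootMultiplicity_iff_isRoot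
        (monic_pencilPoly (matC A B γ) θ₀).ne_zero (t := z₀)).2
        ⟨by rw [Polynomial.IsRoot, eval_pencilPoly]; exact hz₀.1, hd⟩
      exact h2.ne' hsimple
  have hfun : fGamma A B γ = fun θ => argSq (z θ) := funext fun θ => (hzmin θ).symm
  rw [hfun]
  exact DifferentiableAt.comp θ₀ (g := argSq) (by rw [hzz]; exact differentiableAt_argSq hslit) hdz

end Differentiability

/-! ### Zeros of `f_γ` as angles of rays meeting a sublevel set -/

section Angles

open Filter Topology
open scoped ComplexOrder

/-- The adjoint of `[A - z I, B]` as a map between Euclidean spaces. -/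
def adjMap (A : Matrix (Fin n) (Fin n) ℂ) (B : Matrix (Fin n) (Fin m) ℂ) (z : ℂ) :
    EuclideanSpace ℂ (Fin n) →L[ℂ] EuclideanSpace ℂ (Fin n ⊕ Fin m) :=
  LinearMap.toContinuousLinearMap (Matrix.toEuclideanLin (Matrix.fromCols (A - z • 1) B)ᴴ)

/-- The isometric inclusion of `ℂⁿ` into `ℂⁿ ⊕ ℂᵐ`. -/
def inlMap (n m : ℕ) : EuclideanSpace ℂ (Fin n) →L[ℂ] EuclideanSpace ℂ (Fin n ⊕ Fin m) :=
  LinearMap.toContinuousLinearMap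
    (Matrix.toEuclideanLin (Matrix.fromRows (1 : Matrix (Fin n) (Fin n) ℂ)
      (0 : Matrix (Fin m) (Fin n) ℂ)))

theorem norm_inlMap (v : EuclideanSpace ℂ (Fin n)) : ‖inlMap n m v‖ = ‖v‖ := by
  rw [EuclideanSpace.norm_eq, EuclideanSpace.norm_eq, Fintype.sum_sum_type]
  simp [inlMap, toLpLin_apply, fromRows_mulVec]

theorem adjMap_apply (A : Matrix (Fin n) (Fin n) ℂ) (B : Matrix (Fin n) (Fin m) ℂ) (z : ℂ)
    (v : EuclideanSpace ℂ (Fin n)) :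
    adjMap A B z v = adjMap A B 0 v - (starRingEnd ℂ z) • inlMap n m v := by
  ext i
  rcases i with i | i <;>
    simp [adjMap, inlMap, toLpLin_apply, fromRows_mulVec,
      conjTranspose_fromCols_eq_fromRows_conjTranspose, sub_mulVec, smul_mulVec]

theorem continuous_adjMap (A : Matrix (Fin n) (Fin n) ℂ) (B : Matrix (Fin n) (Fin m) ℂ) :
    Continuous fun x : ℂ × EuclideanSpace ℂ (Fin n) => adjMap A B x.1 x.2 := by
  have hconj : Continuous fun z : ℂ => starRingEnd ℂ z := Complex.continuous_conj
  have h : (fun x : ℂ × EuclideanSpace ℂ (Fin n) => adjMap A B x.1 x.2)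
      = fun x => adjMap A B 0 x.2 - (starRingEnd ℂ x.1) • inlMap n m x.2 :=
    funext fun x => adjMap_apply A B x.1 x.2
  rw [h]
  fun_prop

theorem norm_adjMap_ge (A : Matrix (Fin n) (Fin n) ℂ) (B : Matrix (Fin n) (Fin m) ℂ) (z : ℂ)
    (v : EuclideanSpace ℂ (Fin n)) :
    (‖z‖ - ‖adjMap A B 0‖) * ‖v‖ ≤ ‖adjMap A B z v‖ := by
  rw [adjMap_apply, sub_mul]
  have h1 := (adjMap A B 0).le_opNorm v
  have h2 := norm_sub_norm_le ((starRingEnd ℂ z) • inlMap n m v) (adjMap A B 0 v)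
  rw [norm_smul, norm_inlMap, RCLike.norm_conj, norm_sub_rev] at h2
  linarith

theorem ofReal_norm_adjMap_sq (A : Matrix (Fin n) (Fin n) ℂ) (B : Matrix (Fin n) (Fin m) ℂ)
    (z : ℂ) (v : EuclideanSpace ℂ (Fin n)) :
    ((‖adjMap A B z v‖ ^ 2 : ℝ) : ℂ)
      = star (v : Fin n → ℂ) ⬝ᵥ ((A - z • 1) * (A - z • 1)ᴴ + B * Bᴴ) *ᵥ (v : Fin n → ℂ) := by
  have h1 : (A - z • 1) * (A - z • 1)ᴴ + B * Bᴴ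
      = fromCols (A - z • 1) B * (fromCols (A - z • 1) B)ᴴ := by
    rw [conjTranspose_fromCols_eq_fromRows_conjTranspose, fromCols_mul_fromRows]
  have h3 : star (v : Fin n → ℂ) ᵥ* fromCols (A - z • 1) B
      = star ((fromCols (A - z • 1) B)ᴴ *ᵥ (v : Fin n → ℂ)) := by
    rw [star_mulVec, conjTranspose_conjTranspose]
  rw [h1, ← mulVec_mulVec, dotProduct_mulVec, h3]
  have h2 := inner_self_eq_norm_sq_to_K (𝕜 := ℂ) (adjMap A B z v)
  rw [EuclideanSpace.inner_eq_star_dotProduct, dotProduct_comm] at h2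
  push_cast
  exact h2.symm

theorem ofReal_norm_sq (v : EuclideanSpace ℂ (Fin n)) :
    ((‖v‖ ^ 2 : ℝ) : ℂ) = star (v : Fin n → ℂ) ⬝ᵥ (v : Fin n → ℂ) := by
  have h2 := inner_self_eq_norm_sq_to_K (𝕜 := ℂ) v
  rw [EuclideanSpace.inner_eq_star_dotProduct, dotProduct_comm] at h2
  push_cast
  exact h2.symm

theorem norm_adjMap_eq_of_mulVec_eq {A : Matrix (Fin n) (Fin n) ℂ} {B : Matrix (Fin n) (Fin m) ℂ}
    {z : ℂ} {γ : ℝ} (hγ : 0 ≤ γ) {y : Fin n → ℂ}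
    (h : ((A - z • 1) * (A - z • 1)ᴴ + B * Bᴴ) *ᵥ y = ((γ : ℂ) ^ 2) • y) :
    ‖adjMap A B z (WithLp.toLp 2 y)‖ = γ * ‖WithLp.toLp 2 y‖ := by
  have h1 := ofReal_norm_adjMap_sq A B z (WithLp.toLp 2 y)
  rw [h, dotProduct_smul, ← ofReal_norm_sq (WithLp.toLp 2 y), smul_eq_mul] at h1
  have h2 : ‖adjMap A B z (WithLp.toLp 2 y)‖ ^ 2 = (γ * ‖WithLp.toLp 2 y‖) ^ 2 := by
    rw [mul_pow]
    exact_mod_cast h1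
  exact (pow_left_inj₀ (norm_nonneg _) (by positivity) two_ne_zero).1 h2

/-- The Hermitian matrix minus `γ²` is positive semidefinite and its form vanishes at `v`, so `v`
lies in its kernel. -/
theorem mulVec_eq_of_norm_adjMap_eq {A : Matrix (Fin n) (Fin n) ℂ} {B : Matrix (Fin n) (Fin m) ℂ}
    {z : ℂ} {γ : ℝ} (hγ : 0 ≤ γ) (hall : ∀ w, γ * ‖w‖ ≤ ‖adjMap A B z w‖)
    {v : EuclideanSpace ℂ (Fin n)} (hv : ‖adjMap A B z v‖ = γ * ‖v‖) :
    ((A - z • 1) * (A - z • 1)ᴴ + B * Bᴴ) *ᵥ (v : Fin n → ℂ) = ((γ : ℂ) ^ 2) • (v : Fin n → ℂ) := by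
  set H := (A - z • 1) * (A - z • 1)ᴴ + B * Bᴴ with hH
  have hform : ∀ w : EuclideanSpace ℂ (Fin n),
      star (w : Fin n → ℂ) ⬝ᵥ (H - ((γ : ℂ) ^ 2) • 1) *ᵥ (w : Fin n → ℂ)
        = ((‖adjMap A B z w‖ ^ 2 - (γ * ‖w‖) ^ 2 : ℝ) : ℂ) := by
    intro w
    rw [sub_mulVec, smul_mulVec, one_mulVec, dotProduct_sub, dotProduct_smul, Complex.ofReal_sub,
      ofReal_norm_adjMap_sq, mul_pow, Complex.ofReal_mul, ofReal_norm_sq]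
    simp [hH]
  have hpsd : (H - ((γ : ℂ) ^ 2) • (1 : Matrix (Fin n) (Fin n) ℂ)).PosSemidef := by
    refine PosSemidef.of_dotProduct_mulVec_nonneg ?_ fun x => ?_
    · have h1 : H.IsHermitian := (isHermitian_mul_conjTranspose_self _).add
        (isHermitian_mul_conjTranspose_self _)
      refine h1.sub ?_
      rw [IsHermitian, conjTranspose_smul, conjTranspose_one]
      simp
    · have := hform (WithLp.toLp 2 x)
      simp only at this
      rw [this]
      have h2 := pow_le_pow_left₀ (by positivity) (hall (WithLp.toLp 2 x)) 2
      exact_mod_cast sub_nonneg.2 h2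
  have h0 := (hpsd.dotProduct_mulVec_zero_iff (v : Fin n → ℂ)).1 (by rw [hform, hv, sub_self]; simp)
  rw [sub_mulVec, smul_mulVec, one_mulVec, sub_eq_zero] at h0
  exact h0

/-- If the smallest singular value at radius `r₀` is at most `γ`, then `γ` is a singular value at
some larger radius on the same ray. -/
theorem exists_crossing {A : Matrix (Fin n) (Fin n) ℂ} {B : Matrix (Fin n) (Fin m) ℂ}
    {γ θ r₀ : ℝ} (hγ : 0 < γ) (hr₀ : 0 ≤ r₀) {v₀ : EuclideanSpace ℂ (Fin n)} (hv₀ : ‖v₀‖ = 1)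
    (h : ‖adjMap A B ((r₀ : ℂ) * Complex.exp (Complex.I * θ)) v₀‖ ≤ γ) :
    ∃ r : ℝ, r₀ ≤ r ∧ Complex.I * (r : ℂ) ∈ pencilSpectrum (matC A B γ) (matD n θ) := by
  have hnorm : ∀ r : ℝ, 0 ≤ r → ‖(r : ℂ) * Complex.exp (Complex.I * θ)‖ = r := fun r hr => by
    rw [norm_mul, mul_comm Complex.I, Complex.norm_exp_ofReal_mul_I, mul_one, Complex.norm_real,
      Real.norm_of_nonneg hr]
  -- By `norm_adjMap_ge`, no unit vector has image of norm at most `γ` beyond this radius.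
  set R := γ + ‖adjMap A B 0‖ with hR
  have hcont : Continuous fun x : ℝ × EuclideanSpace ℂ (Fin n) =>
      ‖adjMap A B ((x.1 : ℂ) * Complex.exp (Complex.I * θ)) x.2‖ :=
    ((continuous_adjMap A B).comp (f := fun x : ℝ × EuclideanSpace ℂ (Fin n) =>
      (((x.1 : ℂ) * Complex.exp (Complex.I * θ)), x.2)) (by fun_prop)).norm
  set S : Set (ℝ × EuclideanSpace ℂ (Fin n)) := (Icc r₀ R ×ˢ Metric.sphere 0 1) ∩
    {x | ‖adjMap A B ((x.1 : ℂ) * Complex.exp (Complex.I * θ)) x.2‖ ≤ γ} with hS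
  have hcpt : IsCompact S := (isCompact_Icc.prod (isCompact_sphere _ _)).inter_right
    (isClosed_le hcont continuous_const)
  have hmem : ∀ r v, r₀ ≤ r → ‖v‖ = 1 →
      ‖adjMap A B ((r : ℂ) * Complex.exp (Complex.I * θ)) v‖ ≤ γ → (r, v) ∈ S := by
    intro r v hr hv hle
    refine ⟨⟨⟨hr, ?_⟩, by simpa using hv⟩, hle⟩
    have := norm_adjMap_ge A B ((r : ℂ) * Complex.exp (Complex.I * θ)) v
    rw [hnorm r (hr₀.trans hr), hv, mul_one] at this
    show r ≤ R
    linarith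
  obtain ⟨⟨r, v⟩, hrv, hmax⟩ := hcpt.exists_isMaxOn ⟨_, hmem r₀ v₀ le_rfl hv₀ h⟩
    continuous_fst.continuousOn
  have hr : r₀ ≤ r := hrv.1.1.1
  have hv : ‖v‖ = 1 := by simpa using hrv.1.2
  have hle : ‖adjMap A B ((r : ℂ) * Complex.exp (Complex.I * θ)) v‖ ≤ γ := hrv.2
  -- Beyond the maximal radius `r` every norm exceeds `γ`; letting `t ↓ r` makes `γ` the minimum at
  -- `r`, attained at `v`.
  have hge1 : ∀ w, ‖w‖ = 1 → γ ≤ ‖adjMap A B ((r : ℂ) * Complex.exp (Complex.I * θ)) w‖ := by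
    intro w hw
    have hc : Tendsto (fun t : ℝ => ‖adjMap A B ((t : ℂ) * Complex.exp (Complex.I * θ)) w‖)
        (𝓝[>] r) (𝓝 ‖adjMap A B ((r : ℂ) * Complex.exp (Complex.I * θ)) w‖) :=
      (hcont.comp (continuous_id.prodMk continuous_const :
        Continuous fun t : ℝ => (t, w))).continuousAt.tendsto.mono_left nhdsWithin_le_nhds
    refine ge_of_tendsto hc ?_
    filter_upwards [self_mem_nhdsWithin] with t ht
    by_contra! hcon
    have h1 : t ≤ r := hmax (hmem t w (hr.trans (le_of_lt ht)) hw hcon.le)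
    exact absurd h1 (not_le.2 ht)
  have hge : ∀ w, γ * ‖w‖ ≤ ‖adjMap A B ((r : ℂ) * Complex.exp (Complex.I * θ)) w‖ := by
    intro w
    by_cases hw : w = 0
    · simp [hw]
    have hw' : (0 : ℝ) < ‖w‖ := norm_pos_iff.2 hw
    have h1 := hge1 (((‖w‖ : ℂ)⁻¹) • w) (by
      rw [norm_smul, norm_inv, Complex.norm_real, norm_norm, inv_mul_cancel₀ hw'.ne'])
    rw [map_smul, norm_smul, norm_inv, Complex.norm_real, norm_norm] at h1
    rwa [inv_mul_eq_div, le_div_iff₀ hw'] at h1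
  have heq : ‖adjMap A B ((r : ℂ) * Complex.exp (Complex.I * θ)) v‖ = γ * ‖v‖ :=
    le_antisymm (by rw [hv, mul_one]; exact hle) (hge v)
  refine ⟨r, hr, (I_mul_mem_pencilSpectrum_iff A B hγ r θ).2 ⟨v, ?_,
    mulVec_eq_of_norm_adjMap_eq hγ.le hge heq⟩⟩
  intro h0
  have : v = 0 := by ext i; exact congrFun h0 i
  rw [this, norm_zero] at hv
  exact zero_ne_one hv

/-- The angles of the rays meeting `{z | σ_min([A - z I, B]) ≤ γ} \ {0}`. -/
theorem fGamma_eq_zero_iff_exists (hn : 0 < n) {A : Matrix (Fin n) (Fin n) ℂ}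
    {B : Matrix (Fin n) (Fin m) ℂ} {γ : ℝ} (h : Admissible A B γ) (θ : ℝ) :
    fGamma A B γ θ = 0 ↔ ∃ r : ℝ, 0 < r ∧ ∃ v : EuclideanSpace ℂ (Fin n), ‖v‖ = 1 ∧
      ‖adjMap A B ((r : ℂ) * Complex.exp (Complex.I * θ)) v‖ ≤ γ := by
  rw [fGamma_eq_zero_iff hn h]
  constructor
  · rintro ⟨r, hr, hz⟩
    obtain ⟨y, hy, hyy⟩ := (I_mul_mem_pencilSpectrum_iff A B h.1 r θ).1 hz
    have h1 := norm_adjMap_eq_of_mulVec_eq h.1.le hyy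
    have hpos : 0 < ‖WithLp.toLp 2 y‖ := norm_pos_iff.2 fun h0 => hy (by
      simpa using congrArg WithLp.ofLp h0)
    refine ⟨r, hr, ((‖WithLp.toLp 2 y‖ : ℂ)⁻¹) • WithLp.toLp 2 y, ?_, ?_⟩
    · rw [norm_smul, norm_inv, Complex.norm_real, norm_norm, inv_mul_cancel₀ hpos.ne']
    · rw [map_smul, norm_smul, norm_inv, Complex.norm_real, norm_norm, h1, mul_comm γ,
        inv_mul_cancel_left₀ hpos.ne']
  · rintro ⟨r, hr, v, hv, hle⟩
    obtain ⟨r', hr', hz⟩ := exists_crossing h.1 hr.le hv hle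
    exact ⟨r', hr.trans_le hr', hz⟩

/-- The angles of the rays meeting `{z | σ_min([A - z I, B]) < γ} \ {0}`. -/
def strictAngles (A : Matrix (Fin n) (Fin n) ℂ) (B : Matrix (Fin n) (Fin m) ℂ) (γ : ℝ) : Set ℝ :=
  {θ | ∃ r : ℝ, 0 < r ∧ ∃ v : EuclideanSpace ℂ (Fin n), ‖v‖ = 1 ∧
      ‖adjMap A B ((r : ℂ) * Complex.exp (Complex.I * θ)) v‖ < γ}

theorem isOpen_strictAngles (A : Matrix (Fin n) (Fin n) ℂ) (B : Matrix (Fin n) (Fin m) ℂ) (γ : ℝ) :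
    IsOpen (strictAngles A B γ) := by
  have : strictAngles A B γ = ⋃ (r : ℝ) (_ : 0 < r) (v : EuclideanSpace ℂ (Fin n)) (_ : ‖v‖ = 1),
      {θ : ℝ | ‖adjMap A B ((r : ℂ) * Complex.exp (Complex.I * θ)) v‖ < γ} := by
    ext θ; simp [strictAngles]
  rw [this]
  refine isOpen_iUnion fun r => isOpen_iUnion fun _ => isOpen_iUnion fun v => isOpen_iUnion fun _ =>
    isOpen_lt ?_ continuous_const
  exact ((continuous_adjMap A B).comp (f := fun θ : ℝ =>
      (((r : ℂ) * Complex.exp (Complex.I * θ)), v)) (by fun_prop)).norm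

theorem strictAngles_subset (hn : 0 < n) {A : Matrix (Fin n) (Fin n) ℂ}
    {B : Matrix (Fin n) (Fin m) ℂ} {γ : ℝ} (h : Admissible A B γ) :
    strictAngles A B γ ⊆ {θ | fGamma A B γ θ = 0} := by
  rintro θ ⟨r, hr, v, hv, hlt⟩
  exact (fGamma_eq_zero_iff_exists hn h θ).2 ⟨r, hr, v, hv, hlt.le⟩

theorem subset_strictAngles (hn : 0 < n) {A : Matrix (Fin n) (Fin n) ℂ}
    {B : Matrix (Fin n) (Fin m) ℂ} {γ₁ γ₂ : ℝ} (h : Admissible A B γ₁) (hlt : γ₁ < γ₂) :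
    {θ | fGamma A B γ₁ θ = 0} ⊆ strictAngles A B γ₂ := by
  intro θ hθ
  obtain ⟨r, hr, v, hv, hle⟩ := (fGamma_eq_zero_iff_exists hn h θ).1 hθ
  exact ⟨r, hr, v, hv, hle.trans_lt hlt⟩

theorem exp_I_add_two_pi (θ : ℝ) (k : ℤ) :
    Complex.exp (Complex.I * ((θ + k * (2 * π) : ℝ) : ℂ)) = Complex.exp (Complex.I * θ) := by
  rw [Complex.exp_eq_exp_iff_exists_int]
  exact ⟨k, by push_cast; ring⟩

theorem isClosed_fGamma_eq_zero (hn : 0 < n) {A : Matrix (Fin n) (Fin n) ℂ}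
    {B : Matrix (Fin n) (Fin m) ℂ} {γ : ℝ} (h : Admissible A B γ) :
    IsClosed {θ | fGamma A B γ θ = 0} :=
  isClosed_eq (continuous_fGamma hn h) continuous_const

theorem zeroSet_subset (A : Matrix (Fin n) (Fin n) ℂ) (B : Matrix (Fin n) (Fin m) ℂ) (γ : ℝ) :
    zeroSet A B γ ⊆ Ioo (-π) π ∩ {θ | fGamma A B γ θ = 0} := by
  intro θ hθ
  refine ⟨?_, (interior_subset hθ).2⟩
  have := interior_mono (t := Ioc (-π) π) (fun x hx => hx.1) hθ
  rwa [interior_Ioc] at this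

theorem inter_strictAngles_subset_zeroSet (hn : 0 < n) {A : Matrix (Fin n) (Fin n) ℂ}
    {B : Matrix (Fin n) (Fin m) ℂ} {γ : ℝ} (h : Admissible A B γ) :
    Ioo (-π) π ∩ strictAngles A B γ ⊆ zeroSet A B γ :=
  interior_maximal (fun _ hθ => ⟨Ioo_subset_Ioc_self hθ.1, strictAngles_subset hn h hθ.2⟩)
    (isOpen_Ioo.inter (isOpen_strictAngles A B γ))

theorem volume_zeroSet_mono (hn : 0 < n) {A : Matrix (Fin n) (Fin n) ℂ}
    {B : Matrix (Fin n) (Fin m) ℂ} {γ₁ γ₂ : ℝ} (h₁ : Admissible A B γ₁) (h₂ : Admissible A B γ₂)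
    (hle : γ₁ ≤ γ₂) : volume (zeroSet A B γ₁) ≤ volume (zeroSet A B γ₂) := by
  refine measure_mono (interior_mono fun θ hθ => ⟨hθ.1, ?_⟩)
  obtain ⟨r, hr, v, hv, hle'⟩ := (fGamma_eq_zero_iff_exists hn h₁ θ).1 hθ.2
  exact (fGamma_eq_zero_iff_exists hn h₂ θ).2 ⟨r, hr, v, hv, hle'.trans hle⟩

theorem volume_Ioo_pi : volume (Ioo (-π) π) = ENNReal.ofReal (2 * π) := by
  rw [Real.volume_Ioo]; congr 1; ring

theorem volume_zeroSet_eq {A : Matrix (Fin n) (Fin n) ℂ}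
    {B : Matrix (Fin n) (Fin m) ℂ} {γ : ℝ} (hall : ∀ θ, fGamma A B γ θ = 0) :
    volume (zeroSet A B γ) = ENNReal.ofReal (2 * π) := by
  have : zeroSet A B γ = Ioo (-π) π := by
    rw [zeroSet, ← interior_Ioc]; congr 1; ext θ; simp [hall θ]
  rw [this, volume_Ioo_pi]

/-- If `γ₂ < γ₁`, then `U \ Z` is open and null in `(-π, π)`, hence empty by periodicity. So `Z` is
clopen: `∅` contradicts positive measure, `ℝ` contradicts measure below `2π`. -/
theorem le_of_volume_zeroSet_le (hn : 0 < n) {A : Matrix (Fin n) (Fin n) ℂ}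
    {B : Matrix (Fin n) (Fin m) ℂ} {γ₁ γ₂ : ℝ} (h₁ : Admissible A B γ₁) (h₂ : Admissible A B γ₂)
    (hpos : 0 < volume (zeroSet A B γ₁)) (hlt : volume (zeroSet A B γ₂) < ENNReal.ofReal (2 * π))
    (hle : volume (zeroSet A B γ₁) ≤ volume (zeroSet A B γ₂)) : γ₁ ≤ γ₂ := by
  by_contra! hγ
  set Z : Set ℝ := {θ | fGamma A B γ₂ θ = 0} with hZ
  set U := strictAngles A B γ₁ with hU
  have hZU : Z ⊆ U := subset_strictAngles hn h₂ hγ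
  have hUopen : IsOpen U := isOpen_strictAngles A B γ₁
  have hZclosed : IsClosed Z := isClosed_fGamma_eq_zero hn h₂
  have hm : volume (Ioo (-π) π ∩ U) ≤ volume (Ioo (-π) π ∩ Z) :=
    (measure_mono (inter_strictAngles_subset_zeroSet hn h₁)).trans
      (hle.trans (measure_mono (zeroSet_subset A B γ₂)))
  have hfin : volume (Ioo (-π) π ∩ Z) ≠ ⊤ :=
    ((measure_mono inter_subset_left).trans_lt (by rw [volume_Ioo_pi]; exact ENNReal.ofReal_lt_top)).ne
  have hnull : volume (Ioo (-π) π ∩ (U \ Z)) = 0 := by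
    rw [inter_sdiff_distrib_left, measure_sdiff (inter_subset_inter_right _ hZU)
      (measurableSet_Ioo.inter hZclosed.measurableSet).nullMeasurableSet hfin]
    exact tsub_eq_zero_of_le hm
  have hDopen : IsOpen (U \ Z) := hUopen.sdiff hZclosed
  have hempty : Ioo (-π) π ∩ (U \ Z) = ∅ := (isOpen_Ioo.inter hDopen).measure_eq_zero_iff _ |>.1 hnull
  have hper : ∀ θ ∈ U \ Z, ∀ k : ℤ, θ + k * (2 * π) ∈ U \ Z := by
    rintro θ ⟨⟨r, hr, v, hv, hlt'⟩, hnZ⟩ k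
    refine ⟨⟨r, hr, v, hv, by rwa [exp_I_add_two_pi]⟩, fun hk => hnZ ?_⟩
    obtain ⟨r, hr, v, hv, hle'⟩ := (fGamma_eq_zero_iff_exists hn h₂ _).1 hk
    rw [exp_I_add_two_pi] at hle'
    exact (fGamma_eq_zero_iff_exists hn h₂ θ).2 ⟨r, hr, v, hv, hle'⟩
  have hD : U \ Z = ∅ := by
    rw [eq_empty_iff_forall_notMem]
    intro θ hθ
    obtain ⟨k, hk, -⟩ := existsUnique_add_zsmul_mem_Ioc Real.two_pi_pos θ (-π)
    rw [zsmul_eq_mul] at hk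
    have hθ' := hper θ hθ k
    set t := θ + k * (2 * π)
    -- The representative `t` may be `π`, outside the open interval; openness allows a small move to
    -- the left.
    have hev : ∀ᶠ s in 𝓝[<] t, s ∈ Ioo (-π) π ∩ (U \ Z) := by
      filter_upwards [nhdsWithin_le_nhds (hDopen.mem_nhds hθ'), Ioo_mem_nhdsLT hk.1] with s hs hs'
      exact ⟨⟨hs'.1, hs'.2.trans_le (by linarith [hk.2])⟩, hs⟩
    obtain ⟨s, hs⟩ := hev.exists
    rw [hempty] at hs
    exact hs
  have hUZ : U = Z := Subset.antisymm (sdiff_eq_empty.1 hD) hZU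
  rcases isClopen_iff.1 (⟨hZclosed, hUZ ▸ hUopen⟩ : IsClopen Z) with h0 | h0
  · have : zeroSet A B γ₂ = ∅ := by
      rw [← subset_empty_iff]
      exact (zeroSet_subset A B γ₂).trans (by rw [← hZ, h0, inter_empty])
    rw [this, measure_empty] at hle
    exact hpos.not_ge hle
  · exact hlt.ne (volume_zeroSet_eq fun θ => by
      have : θ ∈ Z := h0 ▸ mem_univ θ
      exact this)

/-- The origin lies in the sublevel set, so every ray starting there has a crossing, at nonzero
radius by admissibility. -/
theorem volume_zeroSet_eq_of_lt (hn : 0 < n) {A : Matrix (Fin n) (Fin n) ℂ}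
    {B : Matrix (Fin n) (Fin m) ℂ} {γ : ℝ} (h : Admissible A B γ) {v : EuclideanSpace ℂ (Fin n)}
    (hv : ‖v‖ = 1) (hlt : ‖adjMap A B 0 v‖ < γ) :
    volume (zeroSet A B γ) = ENNReal.ofReal (2 * π) := by
  refine volume_zeroSet_eq fun θ => (fGamma_eq_zero_iff hn h θ).2 ?_
  obtain ⟨r, hr, hz⟩ := exists_crossing (r₀ := 0) (θ := θ) h.1 le_rfl hv (by simpa using hlt.le)
  refine ⟨r, lt_of_le_of_ne hr ?_, hz⟩
  rintro rfl
  exact zero_notMem_pencilSpectrum h θ (by simpa using hz)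

theorem volume_zeroSet_pos_of_lt (hn : 0 < n) {A : Matrix (Fin n) (Fin n) ℂ}
    {B : Matrix (Fin n) (Fin m) ℂ} {γ : ℝ} (h : Admissible A B γ) {v : EuclideanSpace ℂ (Fin n)}
    (hv : ‖v‖ = 1) {z : ℂ} (hlt : ‖adjMap A B z v‖ < γ) : 0 < volume (zeroSet A B γ) := by
  have hopen : IsOpen {w : ℂ | ‖adjMap A B w v‖ < γ} := by
    refine isOpen_lt ?_ continuous_const
    exact ((continuous_adjMap A B).comp (f := fun w : ℂ => (w, v)) (by fun_prop)).norm
  -- A small vertical shift leaves the negative real axis and the origin, so that `arg w` is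
  -- interior to `(-π, π)`.
  obtain ⟨w, hw, hws⟩ : ∃ w : ℂ, ‖adjMap A B w v‖ < γ ∧ w ∈ Complex.slitPlane := by
    have hc : ContinuousAt (fun t : ℝ => z + (t : ℂ) * Complex.I) 0 := by fun_prop
    have hc' := hc.eventually (hopen.mem_nhds (by simpa using hlt))
    have hne : ∀ᶠ t : ℝ in 𝓝[>] 0, t ≠ -z.im := by
      by_cases hz : z.im = 0
      · filter_upwards [self_mem_nhdsWithin] with t ht
        rw [hz, neg_zero]; exact ne_of_gt ht
      · exact nhdsWithin_le_nhds (isOpen_ne.mem_nhds (by simpa [eq_comm] using hz))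
    obtain ⟨t, ht, ht'⟩ := ((hc'.filter_mono nhdsWithin_le_nhds).and hne).exists
    refine ⟨_, ht, Or.inr ?_⟩
    simp only [Complex.add_im, Complex.mul_im, Complex.ofReal_re, Complex.I_im, Complex.ofReal_im,
      Complex.I_re, mul_one, mul_zero, add_zero]
    intro h0
    exact ht' (by linarith)
  have hmem : w.arg ∈ Ioo (-π) π ∩ strictAngles A B γ := by
    refine ⟨⟨Complex.neg_pi_lt_arg w, lt_of_le_of_ne (Complex.arg_le_pi w)
      (Complex.mem_slitPlane_iff_arg.1 hws).1⟩, ‖w‖,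
      norm_pos_iff.2 (Complex.slitPlane_ne_zero hws), v, hv, ?_⟩
    rwa [mul_comm Complex.I, Complex.norm_mul_exp_arg_mul_I]
  exact ((isOpen_Ioo.inter (isOpen_strictAngles A B γ)).measure_pos volume ⟨_, hmem⟩).trans_le
    (measure_mono (inter_strictAngles_subset_zeroSet hn h))

end Angles

/-! ### Controllability and the Hautus test -/

section Uncontrollability

open Filter Topology

section Controllability

open scoped Matrix.Norms.Operator in
theorem hasDerivAt_exp_smul_entry (A : Matrix (Fin n) (Fin n) ℂ) (t : ℝ) (i j : Fin n) :
    HasDerivAt (fun s : ℝ => NormedSpace.exp (s • A) i j) ((A * NormedSpace.exp (t • A)) i j) t :=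
  ((Matrix.entryLinearMap ℝ ℂ i j).toContinuousLinearMap.hasFDerivAt).comp_hasDerivAt t
    (hasDerivAt_exp_smul_const' A t)

theorem hasDerivAt_mulVec {p q : Type*} [Fintype p] [Fintype q] {M : ℝ → Matrix p q ℂ}
    {M' : Matrix p q ℂ} {x : ℝ → q → ℂ} {x' : q → ℂ} {t : ℝ}
    (hM : ∀ i j, HasDerivAt (fun s => M s i j) (M' i j) t) (hx : HasDerivAt x x' t) :
    HasDerivAt (fun s => M s *ᵥ x s) (M' *ᵥ x t + M t *ᵥ x') t := by
  rw [hasDerivAt_pi] at hx ⊢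
  intro i
  have := HasDerivAt.fun_sum (u := Finset.univ) fun j _ => (hM i j).mul (hx j)
  rw [Finset.sum_add_distrib] at this
  exact this

theorem continuous_exp_smul (A : Matrix (Fin n) (Fin n) ℂ) :
    Continuous fun t : ℝ => NormedSpace.exp (t • A) :=
  continuous_pi fun i => continuous_pi fun j =>
    continuous_iff_continuousAt.2 fun t => (hasDerivAt_exp_smul_entry A t i j).continuousAt

theorem exp_smul_mul_exp_neg_smul (A : Matrix (Fin n) (Fin n) ℂ) (t : ℝ) :
    NormedSpace.exp (t • A) * NormedSpace.exp ((-t) • A) = 1 := by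
  rw [← Matrix.exp_add_of_commute _ _ (((Commute.refl A).smul_left t).smul_right (-t)),
    ← add_smul, add_neg_cancel, zero_smul, NormedSpace.exp_zero]

theorem continuous_exp_mul_mulVec (A : Matrix (Fin n) (Fin n) ℂ) (B : Matrix (Fin n) (Fin m) ℂ)
    (u : C(ℝ, Fin m → ℂ)) :
    Continuous fun s : ℝ => (NormedSpace.exp ((-s) • A) * B) *ᵥ u s :=
  (((continuous_exp_smul A).comp continuous_neg).matrix_mul continuous_const).matrix_mulVec
    u.continuous

/-- The map sending a control `u` to `∫₀ᵀ e^{-sA} B u(s) ds`. -/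
def reachMap (A : Matrix (Fin n) (Fin n) ℂ) (B : Matrix (Fin n) (Fin m) ℂ) (T : ℝ) :
    C(ℝ, Fin m → ℂ) →ₗ[ℂ] (Fin n → ℂ) where
  toFun u := ∫ s in (0 : ℝ)..T, (NormedSpace.exp ((-s) • A) * B) *ᵥ u s
  map_add' u v := by
    rw [← intervalIntegral.integral_add ((continuous_exp_mul_mulVec A B u).intervalIntegrable _ _)
      ((continuous_exp_mul_mulVec A B v).intervalIntegrable _ _)]
    simp only [ContinuousMap.add_apply, mulVec_add]
  map_smul' c u := by
    simp only [ContinuousMap.smul_apply, mulVec_smul, RingHom.id_apply]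
    exact intervalIntegral.integral_smul _ _

/-- Variation of constants: `u` steers `x₀` to `x₁` once its image under `reachMap` is `e^{-TA} x₁ -
x₀`. -/
theorem isControllable_of_surjective {A : Matrix (Fin n) (Fin n) ℂ} {B : Matrix (Fin n) (Fin m) ℂ}
    (h : ∀ T : ℝ, 0 < T → Function.Surjective (reachMap A B T)) : IsControllable A B := by
  intro T hT x₀ x₁
  obtain ⟨u, hu⟩ := h T hT (NormedSpace.exp ((-T) • A) *ᵥ x₁ - x₀)
  refine ⟨u, fun t => NormedSpace.exp (t • A) *ᵥ
    (x₀ + ∫ s in (0 : ℝ)..t, (NormedSpace.exp ((-s) • A) * B) *ᵥ u s), u.continuous.continuousOn,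
    fun t _ => HasDerivAt.hasDerivWithinAt ?_, ?_, ?_⟩
  · have h1 := ((continuous_exp_mul_mulVec A B u).integral_hasStrictDerivAt 0 t).hasDerivAt
    have h2 := hasDerivAt_mulVec (hasDerivAt_exp_smul_entry A t) (h1.const_add x₀)
    rw [mulVec_mulVec, ← Matrix.mul_assoc, exp_smul_mul_exp_neg_smul, Matrix.one_mul] at h2
    rwa [mulVec_mulVec]
  · simp
  · have h3 : (∫ s in (0 : ℝ)..T, (NormedSpace.exp ((-s) • A) * B) *ᵥ u s)
        = NormedSpace.exp ((-T) • A) *ᵥ x₁ - x₀ := hu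
    simp only [h3]
    rw [add_sub_cancel, mulVec_mulVec, exp_smul_mul_exp_neg_smul, one_mulVec]

/-- The left annihilator of `e^{-sA} B`, `s ∈ [0, T]`. -/
def annihilator (A : Matrix (Fin n) (Fin n) ℂ) (B : Matrix (Fin n) (Fin m) ℂ) (T : ℝ) :
    Submodule ℂ (Fin n → ℂ) where
  carrier := {y | ∀ s ∈ Icc 0 T, y ᵥ* (NormedSpace.exp ((-s) • A) * B) = 0}
  add_mem' ha hb s hs := by rw [add_vecMul, ha s hs, hb s hs, add_zero]
  zero_mem' s _ := zero_vecMul _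
  smul_mem' c y hy s hs := by rw [smul_vecMul, hy s hs, smul_zero]

/-- A nonzero functional `y` kills the proper range. Testing it on the control `star (y e^{-sA} B)`
gives `∫ ‖y e^{-sA} B‖² = 0`, and continuity makes the integrand vanish. -/
theorem annihilator_ne_bot {A : Matrix (Fin n) (Fin n) ℂ} {B : Matrix (Fin n) (Fin m) ℂ} {T : ℝ}
    (hT : 0 < T) (h : ¬ Function.Surjective (reachMap A B T)) : annihilator A B T ≠ ⊥ := by
  rw [← LinearMap.range_eq_top] at h
  obtain ⟨f, hf, hker⟩ := Submodule.exists_le_ker_of_lt_top _ (lt_top_iff_ne_top.2 h)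
  set y : Fin n → ℂ := fun i => f (Pi.single i 1) with hy
  have hfy : ∀ x, f x = y ⬝ᵥ x := by
    intro x
    conv_lhs => rw [pi_eq_sum_univ' x]
    simp [hy, dotProduct, mul_comm]
  have hy0 : y ≠ 0 := by
    intro h0
    exact hf (LinearMap.ext fun x => by rw [hfy, h0]; simp)
  set g : ℝ → Fin m → ℂ := fun s => y ᵥ* (NormedSpace.exp ((-s) • A) * B) with hg
  have hgc : Continuous g := continuous_const.matrix_vecMul
    (((continuous_exp_smul A).comp continuous_neg).matrix_mul continuous_const)
  have hzero : ∫ s in (0 : ℝ)..T, ∑ j, ‖g s j‖ ^ 2 = 0 := by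
    set u : C(ℝ, Fin m → ℂ) := ⟨fun s => star (g s), hgc.star⟩ with hu
    have h1 : f (reachMap A B T u) = 0 := hker ⟨u, rfl⟩
    have h2 : f (reachMap A B T u)
        = ∫ s in (0 : ℝ)..T, f ((NormedSpace.exp ((-s) • A) * B) *ᵥ u s) :=
      ((f.toContinuousLinearMap).intervalIntegral_comp_comm
        ((continuous_exp_mul_mulVec A B u).intervalIntegrable 0 T)).symm
    have h3 : ∀ s, f ((NormedSpace.exp ((-s) • A) * B) *ᵥ u s) = ((∑ j, ‖g s j‖ ^ 2 : ℝ) : ℂ) := by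
      intro s
      rw [hfy, dotProduct_mulVec]
      simp only [hu, ContinuousMap.coe_mk, dotProduct, Pi.star_apply, Complex.ofReal_sum]
      refine Finset.sum_congr rfl fun j _ => ?_
      rw [RCLike.star_def, Complex.mul_conj, Complex.normSq_eq_norm_sq]
    simp only [h3] at h2
    rw [h1, intervalIntegral.integral_ofReal] at h2
    exact_mod_cast h2.symm
  have hmem : y ∈ annihilator A B T := by
    intro s hs
    by_contra hne
    refine (intervalIntegral.integral_pos hT (f := fun s => ∑ j, ‖g s j‖ ^ 2) ?_ ?_
      ⟨s, hs, ?_⟩).ne' hzero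
    · exact (continuous_finsetSum _ fun j _ =>
        ((continuous_apply j).comp hgc).norm.pow 2).continuousOn
    · exact fun s _ => Finset.sum_nonneg fun j _ => by positivity
    · obtain ⟨j, hj⟩ := Function.ne_iff.1 hne
      exact Finset.sum_pos' (fun j _ => by positivity)
        ⟨j, Finset.mem_univ j, by have := norm_pos_iff.2 hj; positivity⟩
  exact fun hbot => hy0 ((Submodule.mem_bot ℂ).1 (hbot ▸ hmem))

/-- Differentiate `y e^{-sA} B = 0` in `s`, within `[0, T]` so that the endpoints are covered. -/
theorem vecMul_mem_annihilator {A : Matrix (Fin n) (Fin n) ℂ} {B : Matrix (Fin n) (Fin m) ℂ}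
    {T : ℝ} (hT : 0 < T) {y : Fin n → ℂ} (hy : y ∈ annihilator A B T) :
    y ᵥ* A ∈ annihilator A B T := by
  intro s hs
  have h1 : HasDerivAt (fun s : ℝ => y ᵥ* (NormedSpace.exp ((-s) • A) * B))
      (-((y ᵥ* A) ᵥ* (NormedSpace.exp ((-s) • A) * B))) s := by
    rw [hasDerivAt_pi]
    intro j
    have h2 : ∀ i k, HasDerivAt (fun r : ℝ => NormedSpace.exp ((-r) • A) i k)
        (-(A * NormedSpace.exp ((-s) • A)) i k) s := fun i k => by
      simpa [Function.comp_def] using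
        (hasDerivAt_exp_smul_entry A (-s) i k).scomp s (hasDerivAt_neg s)
    have h3 := HasDerivAt.fun_sum (u := Finset.univ) fun i _ =>
      (HasDerivAt.fun_sum (u := Finset.univ) fun k _ => (h2 i k).mul_const (B k j)).const_mul (y i)
    convert! h3 using 1
    rw [vecMul_vecMul, ← Matrix.mul_assoc]
    simp [vecMul, dotProduct, Matrix.mul_apply (M := A * _)]
  have h4 : HasDerivWithinAt (fun s : ℝ => y ᵥ* (NormedSpace.exp ((-s) • A) * B)) 0 (Icc 0 T) s :=
    (hasDerivWithinAt_const s (Icc 0 T) (0 : Fin m → ℂ)).congr hy (hy s hs)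
  have h5 := (uniqueDiffOn_Icc hT s hs).eq_deriv _ h1.hasDerivWithinAt h4
  exact neg_eq_zero.1 h5

/-- The Popov–Belevitch–Hautus test. -/
theorem exists_left_eigenvector_of_not_isControllable {A : Matrix (Fin n) (Fin n) ℂ}
    {B : Matrix (Fin n) (Fin m) ℂ} (h : ¬ IsControllable A B) :
    ∃ (z : ℂ) (y : Fin n → ℂ), y ≠ 0 ∧ y ᵥ* A = z • y ∧ y ᵥ* B = 0 := by
  obtain ⟨T, hT, hns⟩ : ∃ T : ℝ, 0 < T ∧ ¬ Function.Surjective (reachMap A B T) := by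
    by_contra! hcon
    exact h (isControllable_of_surjective hcon)
  have hne := annihilator_ne_bot hT hns
  have : Nontrivial (annihilator A B T) := Submodule.nontrivial_iff_ne_bot.2 hne
  -- The annihilator is nonzero and invariant under `y ↦ y A`, so it contains an eigenvector; `s =
  -- 0` then gives `y B = 0`.
  obtain ⟨z, hz⟩ := Module.End.exists_eigenvalue
    ((Matrix.vecMulLinear A).restrict (p := annihilator A B T) (q := annihilator A B T)
      fun y hy => vecMul_mem_annihilator hT hy)
  obtain ⟨y, hy⟩ := hz.exists_hasEigenvector
  refine ⟨z, y, fun h0 => hy.2 (Subtype.ext h0), ?_, ?_⟩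
  · exact congrArg Subtype.val hy.apply_eq_smul
  · have := y.2 0 ⟨le_rfl, hT.le⟩
    simpa using this

/-- Makes the set defining `distUncontrollability` nonempty, so that its infimum can be approximated
from within. -/
theorem not_isControllable_zero (hn : 0 < n) :
    ¬ IsControllable (0 : Matrix (Fin n) (Fin n) ℂ) (0 : Matrix (Fin n) (Fin m) ℂ) := by
  intro h
  obtain ⟨u, x, -, hx, h0, h1⟩ := h 1 one_pos 0 1
  have hc : ∀ t ∈ Icc (0 : ℝ) 1, x t = x 0 := by
    refine constant_of_derivWithin_zero (fun t ht => (hx t ht).differentiableWithinAt) fun t ht => ?_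
    have ht' := Ico_subset_Icc_self ht
    rw [(hx t ht').derivWithin (uniqueDiffOn_Icc one_pos t ht')]
    simp
  have h2 := hc 1 ⟨zero_le_one, le_rfl⟩
  rw [h0, h1] at h2
  simpa using congrFun h2 ⟨0, hn⟩

end Controllability

/-! ### Contracted unit vectors from `τ` and from `σ_min` -/

open scoped Matrix.Norms.L2Operator in
theorem exists_norm_adjMap_lt_of_distUncontrollability_lt (hn : 0 < n)
    {A : Matrix (Fin n) (Fin n) ℂ} {B : Matrix (Fin n) (Fin m) ℂ} {γ : ℝ}
    (h : distUncontrollability A B < γ) :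
    ∃ (z : ℂ) (v : EuclideanSpace ℂ (Fin n)), ‖v‖ = 1 ∧ ‖adjMap A B z v‖ < γ := by
  rw [distUncontrollability] at h
  obtain ⟨d, ⟨A', B', hunc, rfl⟩, hd⟩ := exists_lt_of_csInf_lt
    (by exact ⟨_, ⟨0, 0, not_isControllable_zero hn, rfl⟩⟩) h
  obtain ⟨z, y, hy, hyA, hyB⟩ := exists_left_eigenvector_of_not_isControllable hunc
  set w : EuclideanSpace ℂ (Fin n) := WithLp.toLp 2 (star y) with hw
  have hw0 : 0 < ‖w‖ := norm_pos_iff.2 fun h0 => hy (by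
    have := congrArg WithLp.ofLp h0
    simpa [hw] using this)
  -- The vector `star y` is killed by `[A' - zI, B']ᴴ`, so only the perturbation acts on it.
  have hadj : adjMap A B z w = WithLp.toLp 2 ((fromCols (A - A') (B - B'))ᴴ *ᵥ star y) := by
    have h1 : fromCols (A - z • 1) B = fromCols (A - A') (B - B') + fromCols (A' - z • 1) B' := by
      ext i (j | j) <;> simp
    have h2 : (fromCols (A' - z • 1) B')ᴴ *ᵥ star y = 0 := by
      rw [← star_vecMul, vecMul_fromCols, vecMul_sub, hyA, hyB, vecMul_smul, vecMul_one, sub_self]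
      ext (i | i) <;> simp
    show WithLp.toLp 2 ((fromCols (A - z • 1) B)ᴴ *ᵥ star y) = _
    rw [h1, conjTranspose_add, add_mulVec, h2, add_zero]
  have hle : ‖adjMap A B z w‖ ≤ ‖fromCols (A - A') (B - B')‖ * ‖w‖ := by
    rw [hadj, ← l2_opNorm_conjTranspose]
    exact l2_opNorm_mulVec _ w
  refine ⟨z, ((‖w‖ : ℂ)⁻¹) • w, ?_, ?_⟩
  · rw [norm_smul, norm_inv, Complex.norm_real, norm_norm, inv_mul_cancel₀ hw0.ne']
  · rw [map_smul, norm_smul, norm_inv, Complex.norm_real, norm_norm, inv_mul_eq_div,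
      div_lt_iff₀ hw0]
    exact hle.trans_lt (mul_lt_mul_of_pos_right hd hw0)

/-- A bound on the `dim F`-th singular value of `T : E → F` gives a unit vector that is contracted
by the adjoint of `T`. -/
theorem exists_norm_adjoint_lt {E F : Type*} [NormedAddCommGroup E] [InnerProductSpace ℂ E]
    [FiniteDimensional ℂ E] [NormedAddCommGroup F] [InnerProductSpace ℂ F] [FiniteDimensional ℂ F]
    (T : E →ₗ[ℂ] F) {k : ℕ} (hF : Module.finrank ℂ F = k + 1) (hE : k < Module.finrank ℂ E)
    {γ : ℝ} (hγ : T.singularValues k < γ) :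
    ∃ v : F, ‖v‖ = 1 ∧ ‖LinearMap.adjoint T v‖ < γ := by
  suffices h : ∃ v : F, v ≠ 0 ∧ ‖LinearMap.adjoint T v‖ = T.singularValues k * ‖v‖ by
    obtain ⟨v, hv, hT⟩ := h
    have hv' : 0 < ‖v‖ := norm_pos_iff.2 hv
    refine ⟨((‖v‖ : ℂ)⁻¹) • v, ?_, ?_⟩
    · rw [norm_smul, norm_inv, Complex.norm_real, norm_norm, inv_mul_cancel₀ hv'.ne']
    · rw [map_smul, norm_smul, norm_inv, Complex.norm_real, norm_norm, hT, mul_comm _ ‖v‖,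
        inv_mul_cancel_left₀ hv'.ne']
      exact hγ
  rcases (T.singularValues_nonneg k).eq_or_lt with h0 | h0
  · have hle := T.singularValues_eq_zero_iff_le_finrank_range.1 h0.symm
    have hne : LinearMap.ker (LinearMap.adjoint T) ≠ ⊥ := by
      intro hbot
      have h1 := (LinearMap.adjoint T).finrank_range_add_finrank_ker
      rw [hbot, finrank_bot, LinearMap.finrank_range_adjoint, hF] at h1
      omega
    obtain ⟨v, hv, hv0⟩ := Submodule.exists_mem_ne_zero_of_ne_bot hne
    refine ⟨v, hv0, ?_⟩
    rw [LinearMap.mem_ker.1 hv, ← h0]; simp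
  · obtain ⟨w, hw⟩ := (T.hasEigenvalue_adjoint_comp_self_sq_singularValues hE).exists_hasEigenvector
    have hw1 : LinearMap.adjoint T (T w) = ((T.singularValues k : ℂ) ^ 2) • w := by
      simpa using hw.apply_eq_smul
    have hne : T w ≠ 0 := by
      intro hz
      rw [hz, map_zero] at hw1
      rcases smul_eq_zero.1 hw1.symm with h1 | h1
      · exact h0.ne' (by exact_mod_cast pow_eq_zero_iff two_ne_zero |>.1 h1)
      · exact hw.2 h1
    have hTw : ‖T w‖ = T.singularValues k * ‖w‖ := by
      have h1 : inner ℂ (T w) (T w) = ((T.singularValues k : ℂ) ^ 2) * inner ℂ w w := by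
        rw [← LinearMap.adjoint_inner_right, hw1, inner_smul_right]
      rw [inner_self_eq_norm_sq_to_K, inner_self_eq_norm_sq_to_K] at h1
      have h2 : ‖T w‖ ^ 2 = (T.singularValues k * ‖w‖) ^ 2 := by
        apply Complex.ofReal_injective
        rw [mul_pow]; push_cast; exact h1
      exact (pow_left_inj₀ (norm_nonneg _) (by positivity) two_ne_zero).1 h2
    refine ⟨T w, hne, ?_⟩
    rw [hw1, norm_smul, hTw, norm_pow, Complex.norm_real, Real.norm_of_nonneg h0.le]
    ring

theorem exists_norm_adjMap_lt_of_rayFun_lt (hn : 0 < n) {A : Matrix (Fin n) (Fin n) ℂ}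
    {B : Matrix (Fin n) (Fin m) ℂ} {γ r θ : ℝ} (h : rayFun A B r θ < γ) :
    ∃ v : EuclideanSpace ℂ (Fin n), ‖v‖ = 1 ∧
      ‖adjMap A B ((r : ℂ) * Complex.exp (Complex.I * θ)) v‖ < γ := by
  rw [rayFun, sigmaMin] at h
  simp only [Fintype.card_sum, Fintype.card_fin, Nat.min_eq_left (Nat.le_add_right n m)] at h
  -- The zero-based index is `n - 1`, and `n = (n - 1) + 1` needs `n > 0`.
  obtain ⟨v, hv, hlt⟩ := exists_norm_adjoint_lt _ (by simp; omega) (by simp; omega) h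
  refine ⟨v, hv, ?_⟩
  rw [← toEuclideanLin_conjTranspose_eq_adjoint] at hlt
  exact hlt

end Uncontrollability

end DTU

end

theorem mainTheorem3 {n m : ℕ} (hn : 0 < n) (A : Matrix (Fin n) (Fin n) ℂ)
    (B : Matrix (Fin n) (Fin m) ℂ) :
    (∀ γ : ℝ, DTU.Admissible A B γ →
      -- the minimum defining `f_γ(θ)` is attained
      (∀ θ ∈ Set.Ioc (-Real.pi) Real.pi,
        IsLeast (DTU.argSq '' DTU.leftSpectrum A B γ θ) (DTU.fGamma A B γ θ)) ∧
      -- (i)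
      (∀ θ ∈ Set.Ioc (-Real.pi) Real.pi, 0 ≤ DTU.fGamma A B γ θ) ∧
      -- (ii)
      (∀ θ ∈ Set.Ioc (-Real.pi) Real.pi,
        (DTU.fGamma A B γ θ = 0 ↔
          ∃ r : ℝ, 0 < r ∧
            Complex.I * (r : ℂ) ∈ DTU.pencilSpectrum (DTU.matC A B γ) (DTU.matD n θ))) ∧
      -- (iii)
      ContinuousOn (DTU.fGamma A B γ) (Set.Ioc (-Real.pi) Real.pi) ∧
      -- (iv)
      (∀ θ ∈ Set.Ioc (-Real.pi) Real.pi, ∀ z ∈ DTU.leftSpectrum A B γ θ,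
        DTU.argSq z = DTU.fGamma A B γ θ →
        (∀ w ∈ DTU.leftSpectrum A B γ θ, DTU.argSq w = DTU.fGamma A B γ θ → w = z) →
        DTU.IsSimplePencilEigenvalue (DTU.matC A B γ) (DTU.matD n θ) z →
        DifferentiableAt ℝ (DTU.fGamma A B γ) θ) ∧
      -- (v)
      (DTU.distUncontrollability A B < γ → 0 < MeasureTheory.volume (DTU.zeroSet A B γ)) ∧
      -- (vii)
      (∀ θ₀ : ℝ, DTU.rayFun A B 0 θ₀ < γ →
        MeasureTheory.volume (DTU.zeroSet A B γ) = ENNReal.ofReal (2 * Real.pi))) ∧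
    -- (vi)
    (∀ γ₁ γ₂ : ℝ, DTU.Admissible A B γ₁ → DTU.Admissible A B γ₂ →
      (γ₁ ≤ γ₂ →
        MeasureTheory.volume (DTU.zeroSet A B γ₁) ≤ MeasureTheory.volume (DTU.zeroSet A B γ₂)) ∧
      (0 < MeasureTheory.volume (DTU.zeroSet A B γ₁) →
        MeasureTheory.volume (DTU.zeroSet A B γ₂) < ENNReal.ofReal (2 * Real.pi) →
        MeasureTheory.volume (DTU.zeroSet A B γ₁) ≤ MeasureTheory.volume (DTU.zeroSet A B γ₂) →
        γ₁ ≤ γ₂)) := by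
  refine ⟨fun γ h => ⟨fun θ _ => DTU.isLeast_fGamma hn A B γ θ,
    fun θ _ => DTU.fGamma_nonneg hn A B γ θ, fun θ _ => DTU.fGamma_eq_zero_iff hn h θ,
    (DTU.continuous_fGamma hn h).continuousOn, ?_, ?_, ?_⟩, fun γ₁ γ₂ h₁ h₂ =>
    ⟨DTU.volume_zeroSet_mono hn h₁ h₂, DTU.le_of_volume_zeroSet_le hn h₁ h₂⟩⟩
  · intro θ _ z hz hmin huniq hsimple
    exact DTU.differentiableAt_fGamma hn h hz hmin huniq hsimple
  · intro hτ
    obtain ⟨z, v, hv, hlt⟩ := DTU.exists_norm_adjMap_lt_of_distUncontrollability_lt hn hτ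
    exact DTU.volume_zeroSet_pos_of_lt hn h hv hlt
  · intro θ₀ hθ₀
    obtain ⟨v, hv, hlt⟩ := DTU.exists_norm_adjMap_lt_of_rayFun_lt hn hθ₀
    exact DTU.volume_zeroSet_eq_of_lt hn h hv (by simpa using hlt)
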